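/- A *paw* is the four-vertex graph consisting of a triangle and one further vertex adjacent to exactly one vertex of the triangle; a graph is *paw-free* if it has no induced subgraph isomorphic to the paw. An instance of Paw-free Completion is a pair $(G,k)$ of a finite simple graph $G$ and an integer $k\ge 0$; it is a yes-instance if there is a set $E_+$ of at most $k$ edges such that $G+E_+$ is paw-free, and a no-instance otherwise. **Theorem.** Paw-free Completion has a $38k$-vertex kernel: there is an algorithm that, given an instance $(G,k)$, computes in time polynomial in the size of $(G,k)$ an instance $(G',k')$ of Paw-free Completion such that 1. $(G',k')$ is a yes-instance if and only if $(G,k)$ is a yes-instance; 2. $k'\le k$; and 3. $|V(G')|\le 38k$, with the sole exception that for a no-instance $(G,0)$ the output is a no-instance with $|V(G')|=4$. -/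

import Mathlib

namespace PawCompletion

/-! ## The problem -/

/-- The paw: a triangle `0, 1, 2` together with a vertex `3` adjacent to `0` only. -/
def paw : SimpleGraph (Fin 4) :=
  SimpleGraph.fromEdgeSet {s(0, 1), s(0, 2), s(1, 2), s(0, 3)}

/-- A graph is paw-free if it has no induced subgraph isomorphic to the paw. -/
def PawFree {V : Type*} (G : SimpleGraph V) : Prop :=
  ¬ paw.IsIndContained G

/-- An instance of Paw-free Completion: a finite simple graph `G`, with vertices numbered
`0, …, n - 1`, and a nonnegative integer `k`. -/
structure Instance where
  n : ℕ
  G : SimpleGraph (Fin n)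
  k : ℕ

/-- `(G, k)` is a yes-instance if adding some set of at most `k` edges makes `G` paw-free. -/
def Instance.IsYes (I : Instance) : Prop :=
  ∃ E : Finset (Sym2 (Fin I.n)), (∀ e ∈ E, ¬ e.IsDiag) ∧ E.card ≤ I.k ∧
    PawFree (I.G ⊔ SimpleGraph.fromEdgeSet (E : Set (Sym2 (Fin I.n))))

/-! ## The machine model

A random access machine, programmed in a structured language: finitely many variables and
two-dimensional arrays (each program mentions only finitely many of them) that hold natural numbers,
with addition and truncated subtraction as the only arithmetic. Every operation costs one
step. One step lengthens the longest number in the machine by at most one bit (there is no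
multiplication) and touches at most one memory cell, so polynomially many steps of this machine
amount to polynomial time on a Turing machine, and conversely. -/

/-- A memory configuration: the values of the variables and of the array cells. -/
structure State where
  var : ℕ → ℕ
  arr : ℕ → ℕ → ℕ → ℕ

/-- `s.setVar x v` is `s` after the assignment of the value `v` to variable `x`. -/
def State.setVar (s : State) (x v : ℕ) : State where
  var := Function.update s.var x v
  arr := s.arr

/-- `s.setArr a i j v` is `s` after the assignment of the value `v` to the cell `a[i, j]`. -/
def State.setArr (s : State) (a i j v : ℕ) : State where
  var := s.var
  arr := fun a' i' j' => if a' = a ∧ i' = i ∧ j' = j then v else s.arr a' i' j'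

/-- Expressions: constants, variables, array cells `a[e₁, e₂]`, sums, truncated differences. -/
inductive Expr where
  | const (c : ℕ)
  | var (x : ℕ)
  | get (a : ℕ) (e₁ e₂ : Expr)
  | add (e₁ e₂ : Expr)
  | sub (e₁ e₂ : Expr)

/-- The value of an expression. -/
def Expr.eval (s : State) : Expr → ℕ
  | .const c => c
  | .var x => s.var x
  | .get a e₁ e₂ => s.arr a (e₁.eval s) (e₂.eval s)
  | .add e₁ e₂ => e₁.eval s + e₂.eval s
  | .sub e₁ e₂ => e₁.eval s - e₂.eval s

/-- The number of steps that the evaluation of an expression takes: one for each operation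
and each constant or variable that it reads. -/
def Expr.cost : Expr → ℕ
  | .const _ => 1
  | .var _ => 1
  | .get _ e₁ e₂ => e₁.cost + e₂.cost + 1
  | .add e₁ e₂ => e₁.cost + e₂.cost + 1
  | .sub e₁ e₂ => e₁.cost + e₂.cost + 1

/-- Programs. In `ite` and `loop`, the test succeeds if the value of the expression is nonzero. -/
inductive Prog where
  | skip
  | assign (x : ℕ) (e : Expr)
  | store (a : ℕ) (e₁ e₂ e : Expr)
  | seq (p q : Prog)
  | ite (e : Expr) (p q : Prog)
  | loop (e : Expr) (p : Prog)

/-- `Exec p s t s'`: the program `p`, started in the configuration `s`, halts after exactly `t`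
steps in the configuration `s'`. -/
inductive Exec : Prog → State → ℕ → State → Prop where
  | skip (s : State) : Exec .skip s 1 s
  | assign (x : ℕ) (e : Expr) (s : State) :
      Exec (.assign x e) s (e.cost + 1) (s.setVar x (e.eval s))
  | store (a : ℕ) (e₁ e₂ e : Expr) (s : State) :
      Exec (.store a e₁ e₂ e) s (e₁.cost + e₂.cost + e.cost + 1)
        (s.setArr a (e₁.eval s) (e₂.eval s) (e.eval s))
  | seq {p q : Prog} {s s' s'' : State} {t t' : ℕ} :
      Exec p s t s' → Exec q s' t' s'' → Exec (.seq p q) s (t + t') s''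
  | ite_true {e : Expr} {p q : Prog} {s s' : State} {t : ℕ} :
      e.eval s ≠ 0 → Exec p s t s' → Exec (.ite e p q) s (e.cost + 1 + t) s'
  | ite_false {e : Expr} {p q : Prog} {s s' : State} {t : ℕ} :
      e.eval s = 0 → Exec q s t s' → Exec (.ite e p q) s (e.cost + 1 + t) s'
  | loop_true {e : Expr} {p : Prog} {s s' s'' : State} {t t' : ℕ} :
      e.eval s ≠ 0 → Exec p s t s' → Exec (.loop e p) s' t' s'' →
        Exec (.loop e p) s (e.cost + 1 + t + t') s''
  | loop_false {e : Expr} {p : Prog} {s : State} :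
      e.eval s = 0 → Exec (.loop e p) s (e.cost + 1) s

/-! ## Polynomial-time computable maps of instances -/

open Classical in
/-- The entry `(i, j)` of the adjacency matrix of `G`, and `0` outside the matrix. -/
noncomputable def adjEntry {n : ℕ} (G : SimpleGraph (Fin n)) (i j : ℕ) : ℕ :=
  if ∃ u v : Fin n, (u : ℕ) = i ∧ (v : ℕ) = j ∧ G.Adj u v then 1 else 0

/-- The initial configuration on input `(G, k)`: variable `0` holds the number of vertices,
variable `1` holds `k`, array `0` holds the adjacency matrix, and all the rest is `0`. -/
noncomputable def Instance.init (I : Instance) : State where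
  var := fun x => if x = 0 then I.n else if x = 1 then I.k else 0
  arr := fun a i j => if a = 0 then adjEntry I.G i j else 0

/-- The configuration `s` holds the instance `I` as its output, in the format of the input. -/
def State.Output (s : State) (I : Instance) : Prop :=
  s.var 0 = I.n ∧ s.var 1 = I.k ∧ ∀ i < I.n, ∀ j < I.n, s.arr 0 i j = adjEntry I.G i j

/-- The size of an instance: the number of vertices plus the number of binary digits of `k`. It is
polynomially related to the length of the encoding by adjacency matrix and binary digits. -/
def Instance.size (I : Instance) : ℕ :=
  I.n + Nat.size I.k

/-- `f` is computable in polynomial time: one program outputs `f I` on every input `I`, within a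
number of steps bounded by a polynomial in the size of `I`. -/
def PolyTimeComputable (f : Instance → Instance) : Prop :=
  ∃ (p : Prog) (b : Polynomial ℕ), ∀ I : Instance, ∃ (t : ℕ) (s : State),
    Exec p I.init t s ∧ t ≤ b.eval I.size ∧ s.Output (f I)

end PawCompletion

namespace PawCompletion

open Finset

section Graphs

open scoped Classical

variable {V : Type*}

/-! ## Paw-free graphs -/

/-! In a paw-free graph every component is triangle-free or complete multipartite. So a completion
of G has to act only in components that contain a triangle, and the non-edges surviving there must
form disjoint cliques. Let H = `obstruction G` be the graph of all non-edges inside such components.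
Completing G with k edges amounts to deleting k edges from H so as to leave a cluster graph
(`exists_pawFree_iff`).

This cluster deletion problem is then shrunk. Suppose a closed neighborhood in H is a clique with
few leaving edges. A solution that splits it already deletes more edges inside than its cut
contains, so it may as well be isolated (`card_missing_isolate_le`). Distinct cliques of this kind
are disjoint (`Good.closedNbhd_eq`), so all of them can be removed at once, at the price of the
edges in `lost` (`hasDeletion_iff`). To bound what remains, consider a part of a solution. Either
each of its vertices loses an edge, or it is the closed neighborhood of a vertex that loses none. In
the latter case it is good and disappears, or its size is at most its nonzero cut plus one. Either
way the remaining vertices of the part number at most twice its deletion incidences, and 2k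
incidences leave at most 4k vertices (`HasDeletion.card_le`).

To return to paws, take the complement of the remaining graph on these vertices and add a universal
vertex (`hasDeletion_obstruction_iff`). This gives at most 4k + 1 vertices, well below 38k for
positive k.

For the running time, everything is expressed by terms with sums over the vertices. These compile to
nested loops (`Term.runs_compile`), and reachability takes n rounds of relaxation. -/

theorem pawFree_iff {G : SimpleGraph V} :
    PawFree G ↔ ∀ a b c d, G.Adj a b → G.Adj a c → G.Adj b c → G.Adj a d → d ≠ b → d ≠ c →
      G.Adj d b ∨ G.Adj d c := by
  constructor
  · intro h a b c d hab hac hbc had hdb hdc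
    by_contra! hn
    refine h ⟨⟨⟨![a, b, c, d], ?_⟩, ?_⟩⟩
    · intro i j hij
      have := hab.ne; have := hac.ne; have := hbc.ne; have := had.ne
      fin_cases i <;> fin_cases j <;> simp_all
    · intro i j
      have h1 := hab.symm; have h2 := hac.symm; have h3 := hbc.symm; have h4 := had.symm
      have h5 : ¬ G.Adj b d := fun h => hn.1 h.symm
      have h6 : ¬ G.Adj c d := fun h => hn.2 h.symm
      change G.Adj (![a, b, c, d] i) (![a, b, c, d] j) ↔ paw.Adj i j
      fin_cases i <;> fin_cases j <;> simp_all [paw]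
  · rintro h ⟨f⟩
    have hadj : ∀ i j, paw.Adj i j ↔ G.Adj (f i) (f j) := fun i j => (f.map_adj_iff).symm
    have := h (f 0) (f 1) (f 2) (f 3)
    rw [← hadj, ← hadj, ← hadj, ← hadj, ← hadj, ← hadj] at this
    simp [paw] at this
    exact absurd (f.injective (this fun h => absurd (f.injective h) (by decide))) (by decide)

/-- In a paw-free graph, each vertex of a component with a triangle lies on a triangle. -/
theorem PawFree.exists_triangle {G : SimpleGraph V} (hG : PawFree G) {x y z w : V}
    (hxy : G.Adj x y) (hyz : G.Adj y z) (hxz : G.Adj x z) (hr : G.Reachable x w) :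
    ∃ a b, G.Adj w a ∧ G.Adj w b ∧ G.Adj a b := by
  rw [pawFree_iff] at hG
  obtain ⟨p⟩ := hr
  induction p generalizing y z with
  | nil => exact ⟨y, z, hxy, hxz, hyz⟩
  | @cons u v w h p ih =>
    by_cases h1 : v = y
    · subst h1; exact ih h.symm hxz hyz
    by_cases h2 : v = z
    · subst h2; exact ih h.symm hxy hyz.symm
    -- The vertex v hangs on the triangle at u, so it is joined to a second corner and forms a
    -- triangle with u and that corner.
    rcases hG u y z v hxy hxz hyz h h1 h2 with h3 | h3
    · exact ih h.symm hxy h3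
    · exact ih h.symm hxz h3

/-- In a paw-free graph, each component with a triangle is complete multipartite. -/
theorem PawFree.adj_or_adj {G : SimpleGraph V} (hG : PawFree G) {x y z b c w : V}
    (hxy : G.Adj x y) (hyz : G.Adj y z) (hxz : G.Adj x z) (hb : G.Reachable x b)
    (hbc : G.Adj b c) (hw : G.Reachable b w) :
    w = b ∨ w = c ∨ G.Adj w b ∨ G.Adj w c := by
  have hG' := pawFree_iff.1 hG
  -- Take a triangle at b. If c is not one of its corners, paw-freeness joins c to another corner.
  have ht : ∀ {b c : V}, G.Reachable x b → G.Adj b c → ∃ t, G.Adj b t ∧ G.Adj c t := by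
    intro b c hb hbc
    obtain ⟨s, t, hs, ht, hst⟩ := hG.exists_triangle hxy hyz hxz hb
    by_cases h1 : c = s
    · subst h1; exact ⟨t, ht, hst⟩
    by_cases h2 : c = t
    · subst h2; exact ⟨s, hs, hst.symm⟩
    rcases hG' b s t c hs ht hst hbc h1 h2 with h3 | h3
    · exact ⟨s, hs, h3⟩
    · exact ⟨t, ht, h3⟩
  -- If v sees c, the triangle v, b, c settles the claim. Otherwise let t complete bc to a triangle.
  -- Then v is joined to t, next u is joined to t because of the triangle v, b, t, and finally u is
  -- joined to b or c because of the triangle t, b, c.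
  have key : ∀ {b c v u : V}, G.Reachable x b → G.Adj b c → G.Adj v b → G.Adj u v →
      u = b ∨ u = c ∨ G.Adj u b ∨ G.Adj u c := by
    intro b c v u hb hbc hvb huv
    by_contra! hn
    obtain ⟨h1, h2, h3, h4⟩ := hn
    obtain ⟨t, hbt, hct⟩ := ht hb hbc
    by_cases hvc : G.Adj v c
    · rcases hG' v b c u hvb hvc hbc huv.symm h1 h2 with h | h <;> contradiction
    have hvc' : v ≠ c := fun h => h4 (h ▸ huv)
    have hvt' : v ≠ t := fun h => hvc (h ▸ hct.symm)
    have hvt : G.Adj v t := by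
      rcases hG' b c t v hbc hbt hct hvb.symm hvc' hvt' with h | h
      · contradiction
      · exact h
    have hut' : u ≠ t := fun h => h3 (h ▸ hbt.symm)
    have hut : G.Adj u t := by
      rcases hG' v b t u hvb hvt hbt huv.symm h1 hut' with h | h
      · contradiction
      · exact h
    rcases hG' t b c u hbt.symm hct.symm hbc hut.symm h1 h2 with h | h <;> contradiction
  have step : ∀ u v, G.Adj u v → (v = b ∨ v = c ∨ G.Adj v b ∨ G.Adj v c) →
      (u = b ∨ u = c ∨ G.Adj u b ∨ G.Adj u c) := by
    rintro u v huv (rfl | rfl | h | h)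
    · exact Or.inr (Or.inr (Or.inl huv))
    · exact Or.inr (Or.inr (Or.inr huv))
    · exact key hb hbc h huv
    · have := key (hb.trans hbc.reachable) hbc.symm h huv
      tauto
  obtain ⟨p⟩ := hw.symm
  clear hw
  induction p with
  | nil => exact Or.inl rfl
  | cons h p ih => exact step _ _ h (ih hb hbc step)

/-! ## Cluster deletion -/

/-- A cluster graph: a disjoint union of complete graphs. -/
def IsCluster (C : SimpleGraph V) : Prop :=
  ∀ ⦃a b c⦄, C.Adj a b → C.Adj b c → a ≠ c → C.Adj a c

/-- The modification of `C` that isolates a set `K` and makes it a clique. -/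
def isolate (C : SimpleGraph V) (K : Finset V) : SimpleGraph V where
  Adj x y := (x ≠ y ∧ x ∈ K ∧ y ∈ K) ∨ (x ∉ K ∧ y ∉ K ∧ C.Adj x y)
  symm := ⟨by
    rintro x y (⟨h1, h2, h3⟩ | ⟨h1, h2, h3⟩)
    · exact Or.inl ⟨h1.symm, h3, h2⟩
    · exact Or.inr ⟨h2, h1, h3.symm⟩⟩
  loopless := ⟨by
    rintro x (⟨h1, -⟩ | ⟨-, -, h⟩)
    · exact h1 rfl
    · exact h.ne rfl⟩

theorem IsCluster.isolate {C : SimpleGraph V} (hC : IsCluster C) (K : Finset V) : IsCluster (isolate C K) := by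
  rintro a b c (⟨h1, h2, h3⟩ | ⟨h1, h2, h3⟩) (⟨k1, k2, k3⟩ | ⟨k1, k2, k3⟩) hac
  · exact Or.inl ⟨hac, h2, k3⟩
  · exact absurd h3 k1
  · exact absurd k2 h2
  · exact Or.inr ⟨h1, k2, hC h3 k3 hac⟩

/-- The ordered pairs that are edges of `H` but not of `C`. -/
noncomputable def missing [Fintype V] (H C : SimpleGraph V) : Finset (V × V) :=
  {p | H.Adj p.1 p.2 ∧ ¬ C.Adj p.1 p.2}

/-- Deleting at most `k` edges makes `H` a cluster graph. -/
def HasDeletion [Fintype V] (H : SimpleGraph V) (k : ℕ) : Prop :=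
  ∃ C ≤ H, IsCluster C ∧ #(missing H C) ≤ 2 * k

/-- Two distinct vertices are adjacent if they are nonadjacent in `G` and belong to the same component
of `G`, and this component contains a triangle. -/
def obstruction (G : SimpleGraph V) : SimpleGraph V where
  Adj u v := u ≠ v ∧ ¬ G.Adj u v ∧ G.Reachable u v ∧
    ∃ x y z, G.Reachable u x ∧ G.Adj x y ∧ G.Adj y z ∧ G.Adj x z
  symm := ⟨by
    rintro u v ⟨h1, h2, h3, x, y, z, h4, h5⟩
    exact ⟨h1.symm, fun h => h2 h.symm, h3.symm, x, y, z, h3.symm.trans h4, h5⟩⟩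
  loopless := ⟨fun u h => h.1 rfl⟩

theorem obstruction_adj {G : SimpleGraph V} {u v : V} :
    (obstruction G).Adj u v ↔ u ≠ v ∧ ¬ G.Adj u v ∧ G.Reachable u v ∧
      ∃ x y z, G.Reachable u x ∧ G.Adj x y ∧ G.Adj y z ∧ G.Adj x z := Iff.rfl

theorem card_filter_adj [Fintype V] (G : SimpleGraph V) [Fintype G.edgeSet] :
    #{p : V × V | G.Adj p.1 p.2} = 2 * #G.edgeFinset := by
  rw [← show ∑ v, G.degree v = 2 * #G.edgeFinset from
    G.sum_degrees_eq_twice_card_edges.trans (by congr!), ← Finset.univ_product_univ, Finset.card_filter,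
    Finset.sum_product]
  refine Finset.sum_congr rfl fun v _ => ?_
  rw [← Finset.card_filter, ← G.card_neighborFinset_eq_degree, G.neighborFinset_eq_filter]

/-! ### Paw-free completion as cluster deletion -/

/-- Non-adjacency is transitive in a component of F with a triangle: by `PawFree.adj_or_adj`, an
F-edge between a and c would force b to be joined to one of them. -/
theorem PawFree.isCluster_obstruction_sdiff {G F : SimpleGraph V} (hF : PawFree F) (hGF : G ≤ F) :
    IsCluster (obstruction G \ F) := by
  rintro a b c ⟨hab, nab⟩ ⟨hbc, nbc⟩ hac
  obtain ⟨-, -, rab, x, y, z, rax, hxy, hyz, hxz⟩ := hab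
  obtain ⟨nbc', -, rbc, -⟩ := hbc
  have nac : ¬ F.Adj a c := by
    intro h
    have := hF.adj_or_adj (hGF hxy) (hGF hyz) (hGF hxz) (rax.mono hGF).symm h (rab.mono hGF)
    rcases this with h | h | h | h
    · subst h; exact nbc ‹_›
    · exact nbc' h
    · exact nab h.symm
    · exact nbc h
  exact ⟨⟨hac, fun h => nac (hGF h), rab.trans rbc, x, y, z, rax, hxy, hyz, hxz⟩, nac⟩

/-- New edges stay inside components of G that contain a triangle. There the remaining non-edges are
exactly the edges of C, and their transitivity excludes a paw. In any other component nothing is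
added, so the triangle of a paw would already be a triangle of G. -/
theorem IsCluster.pawFree_sup_obstruction_sdiff {G C : SimpleGraph V} (hC : IsCluster C)
    (hle : C ≤ obstruction G) : PawFree (G ⊔ obstruction G \ C) := by
  rw [pawFree_iff]
  intro a b c d hab hac hbc had hdb hdc
  have reach : ∀ {u v}, (G ⊔ obstruction G \ C).Adj u v → G.Reachable u v := by
    rintro u v (h | h)
    · exact h.reachable
    · exact h.1.2.2.1
  by_contra! hn
  by_cases ht : ∃ x y z, G.Reachable a x ∧ G.Adj x y ∧ G.Adj y z ∧ G.Adj x z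
  · obtain ⟨x, y, z, rax, hxyz⟩ := ht
    have rad := reach had
    have hC' : ∀ v, G.Reachable a v → d ≠ v → ¬ (G ⊔ obstruction G \ C).Adj d v → C.Adj d v := by
      intro v rv hv h
      by_contra hc
      have h1 : ¬ G.Adj d v := fun h' => h (Or.inl h')
      exact h (Or.inr ⟨⟨hv, h1, rad.symm.trans rv, x, y, z, rad.symm.trans rax, hxyz⟩, hc⟩)
    have h1 := hC' b (reach hab) hdb hn.1
    have h2 := hC' c (reach hac) hdc hn.2
    have h3 := hC h1.symm h2 hbc.ne
    rcases hbc with h | h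
    · exact (hle h3).2.1 h
    · exact h.2 h3
  · have hG : ∀ {u v}, G.Reachable a u → (G ⊔ obstruction G \ C).Adj u v → G.Adj u v := by
      rintro u v r (h | ⟨⟨-, -, -, x, y, z, h1, h2⟩, -⟩)
      · exact h
      · exact absurd ⟨x, y, z, r.trans h1, h2⟩ ht
    exact ht ⟨a, b, c, .rfl, hG .rfl hab, hG (reach hab) hbc, hG .rfl hac⟩

/-- Added edges outside the obstruction graph are superfluous, so a completion corresponds to the
obstruction edges that it adds, that is, to those that C lacks. The factor 2 hidden in `HasDeletion`
is there because `missing` consists of ordered pairs. -/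
theorem exists_pawFree_iff [Fintype V] {G : SimpleGraph V} {k : ℕ} :
    (∃ E : Finset (Sym2 V), (∀ e ∈ E, ¬ e.IsDiag) ∧ #E ≤ k ∧
      PawFree (G ⊔ SimpleGraph.fromEdgeSet (E : Set (Sym2 V)))) ↔ HasDeletion (obstruction G) k := by
  constructor
  · rintro ⟨E, hE, hk, hF⟩
    set F := SimpleGraph.fromEdgeSet (E : Set (Sym2 V)) with hFdef
    refine ⟨_, sdiff_le, hF.isCluster_obstruction_sdiff le_sup_left, ?_⟩
    have : #F.edgeFinset ≤ #E := by
      refine card_le_card fun e he => ?_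
      rw [SimpleGraph.mem_edgeFinset, hFdef, SimpleGraph.edgeSet_fromEdgeSet] at he
      exact he.1
    calc _ ≤ #{p : V × V | F.Adj p.1 p.2} := by
          refine card_le_card fun p hp => ?_
          simp only [missing, mem_filter, mem_univ, true_and, SimpleGraph.sdiff_adj,
            SimpleGraph.sup_adj, not_and, not_not] at hp ⊢
          exact (hp.2 hp.1).resolve_left hp.1.2.1
      _ = 2 * #F.edgeFinset := by convert card_filter_adj F
      _ ≤ 2 * k := by omega
  · rintro ⟨C, hle, hC, hk⟩
    refine ⟨(obstruction G \ C).edgeFinset, fun e he => ?_, ?_, ?_⟩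
    · exact SimpleGraph.not_isDiag_of_mem_edgeFinset he
    · have := card_filter_adj (obstruction G \ C)
      simp only [SimpleGraph.sdiff_adj] at this
      rw [missing, this] at hk
      omega
    · rw [SimpleGraph.coe_edgeFinset, SimpleGraph.fromEdgeSet_edgeSet]
      exact hC.pawFree_sup_obstruction_sdiff hle

theorem Instance.isYes_iff (I : Instance) : I.IsYes ↔ HasDeletion (obstruction I.G) I.k :=
  exists_pawFree_iff

end Graphs

section Kernel

open scoped Classical

variable {V : Type*} [Fintype V] {H C : SimpleGraph V} {u v x y : V}

/-! ## Good cliques -/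

/-- The closed neighborhood of `v`. -/
noncomputable def closedNbhd (H : SimpleGraph V) (v : V) : Finset V :=
  {x | v = x ∨ H.Adj v x}

/-- The number of edges that leave `K`. -/
noncomputable def cut (H : SimpleGraph V) (K : Finset V) : ℕ :=
  #{p : V × V | p.1 ∈ K ∧ p.2 ∉ K ∧ H.Adj p.1 p.2}

/-- The closed neighborhood of `v` is a clique that it is optimal to separate from the rest. -/
def Good (H : SimpleGraph V) (v : V) : Prop :=
  (∀ x ∈ closedNbhd H v, ∀ y ∈ closedNbhd H v, x = y ∨ H.Adj x y) ∧
    -- The margin 2 forces overlapping good cliques to coincide. Margin 1 would not: consider the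
    -- two ends of a path on three vertices. The alternative of an empty cut adds only the isolated
    -- vertices.
    (cut H (closedNbhd H v) = 0 ∨ cut H (closedNbhd H v) + 2 ≤ #(closedNbhd H v))

/-- `x` and `y` belong to a common good clique. -/
def Same (H : SimpleGraph V) (x y : V) : Prop :=
  ∃ v, Good H v ∧ x ∈ closedNbhd H v ∧ y ∈ closedNbhd H v

/-- What remains when all good cliques are removed. -/
def residual (H : SimpleGraph V) : SimpleGraph V where
  Adj x y := H.Adj x y ∧ ¬ Same H x x ∧ ¬ Same H y y
  symm := ⟨fun _ _ h => ⟨h.1.symm, h.2.2, h.2.1⟩⟩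
  loopless := ⟨fun _ h => h.1.ne rfl⟩

/-- The ordered pairs that are edges at a good clique but not within one. -/
noncomputable def lost (H : SimpleGraph V) : Finset (V × V) :=
  {p | H.Adj p.1 p.2 ∧ (Same H p.1 p.1 ∨ Same H p.2 p.2) ∧ ¬ Same H p.1 p.2}

theorem mem_closedNbhd : x ∈ closedNbhd H v ↔ v = x ∨ H.Adj v x := by
  simp [closedNbhd]

theorem self_mem_closedNbhd : v ∈ closedNbhd H v := mem_closedNbhd.2 (Or.inl rfl)

theorem Same.symm (h : Same H x y) : Same H y x := by
  obtain ⟨v, h, hx, hy⟩ := h; exact ⟨v, h, hy, hx⟩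

/-- Let the cliques share a ≥ 1 vertices and have b and c private ones. Their cuts are at least ac
and ab, so ac + 2 ≤ a + b and ab + 2 ≤ a + c, which is impossible for positive b and c. If one
clique contains the other, it contains the other's center, whose closed neighborhood therefore
contains it in turn. An empty cut forces such a containment. -/
theorem Good.closedNbhd_eq (hu : Good H u) (hv : Good H v) (hxu : x ∈ closedNbhd H u)
    (hxv : x ∈ closedNbhd H v) : closedNbhd H u = closedNbhd H v := by
  have sub : ∀ {u v}, Good H u → closedNbhd H v ⊆ closedNbhd H u →
      closedNbhd H u ⊆ closedNbhd H v := by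
    intro u v hu h y hy
    exact mem_closedNbhd.2 (hu.1 _ (h self_mem_closedNbhd) _ hy)
  have zero : ∀ {u v}, Good H u → Good H v → x ∈ closedNbhd H u → x ∈ closedNbhd H v →
      cut H (closedNbhd H u) = 0 → closedNbhd H u = closedNbhd H v := by
    intro u v hu hv hxu hxv h0
    have h : closedNbhd H v ⊆ closedNbhd H u := by
      intro y hy
      rcases hv.1 _ hxv _ hy with rfl | h
      · exact hxu
      by_contra hyu
      rw [cut, card_eq_zero, filter_eq_empty_iff] at h0
      exact h0 (mem_univ (x, y)) ⟨hxu, hyu, h⟩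
    exact (sub hu h).antisymm h
  rcases hu.2 with h0 | h1
  · exact zero hu hv hxu hxv h0
  rcases hv.2 with h0 | h2
  · exact (zero hv hu hxv hxu h0).symm
  by_contra hne
  have cutle : ∀ {u v}, Good H v → #(closedNbhd H u ∩ closedNbhd H v) *
      #(closedNbhd H v \ closedNbhd H u) ≤ cut H (closedNbhd H u) := by
    intro u v hv
    rw [← card_product]
    refine card_le_card fun p hp => ?_
    simp only [mem_product, mem_inter, mem_sdiff] at hp
    refine mem_filter.2 ⟨mem_univ _, hp.1.1, hp.2.2, ?_⟩
    refine (hv.1 _ hp.1.2 _ hp.2.1).resolve_left fun h => hp.2.2 (h ▸ hp.1.1)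
  have c1 := cutle (u := u) hv
  have c2 := cutle (u := v) hu
  rw [inter_comm] at c2
  have e1 := card_inter_add_card_sdiff (closedNbhd H u) (closedNbhd H v)
  have e2 := card_inter_add_card_sdiff (closedNbhd H v) (closedNbhd H u)
  rw [inter_comm] at e2
  have p1 : 0 < #(closedNbhd H u ∩ closedNbhd H v) := card_pos.2 ⟨x, mem_inter.2 ⟨hxu, hxv⟩⟩
  have p2 : 0 < #(closedNbhd H u \ closedNbhd H v) := by
    rw [card_pos, sdiff_nonempty]
    exact fun h => hne (h.antisymm (sub hv h))
  have p3 : 0 < #(closedNbhd H v \ closedNbhd H u) := by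
    rw [card_pos, sdiff_nonempty]
    exact fun h => hne ((sub hu h).antisymm h)
  generalize #(closedNbhd H u ∩ closedNbhd H v) = a at *
  generalize #(closedNbhd H u \ closedNbhd H v) = b at *
  generalize #(closedNbhd H v \ closedNbhd H u) = c at *
  obtain ⟨a, rfl⟩ := Nat.exists_eq_add_of_lt p1
  obtain ⟨b, rfl⟩ := Nat.exists_eq_add_of_lt p2
  obtain ⟨c, rfl⟩ := Nat.exists_eq_add_of_lt p3
  -- Here a, b, c have been lowered by one, and the two inequalities add up to a(b + c) + 2 ≤ 0.
  nlinarith [Nat.zero_le (a * b), Nat.zero_le (a * c)]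

/-- `C` contains the closed neighborhood of `v` as a component that is a complete graph. -/
def Isolates (H C : SimpleGraph V) (v : V) : Prop :=
  ∀ x ∈ closedNbhd H v, ∀ y, C.Adj x y ↔ x ≠ y ∧ y ∈ closedNbhd H v

theorem isolate_le (hle : C ≤ H) (hv : Good H v) : isolate C (closedNbhd H v) ≤ H := by
  rintro x y (⟨h1, h2, h3⟩ | ⟨-, -, h⟩)
  · exact (hv.1 x h2 y h3).resolve_left h1
  · exact hle h

theorem isolates_isolate : Isolates H (isolate C (closedNbhd H v)) v := by
  intro x hx y
  constructor
  · rintro (⟨h1, -, h3⟩ | ⟨h1, -⟩)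
    · exact ⟨h1, h3⟩
    · exact absurd hx h1
  · rintro ⟨h1, h2⟩
    exact Or.inl ⟨h1, hx, h2⟩

/-- Good cliques are equal or disjoint, so isolating the second one either isolates the first again
or does not touch it. -/
theorem Isolates.isolate (hu : Good H u) (hv : Good H v) (h : Isolates H C u) :
    Isolates H (isolate C (closedNbhd H v)) u := by
  by_cases hd : ∃ x, x ∈ closedNbhd H u ∧ x ∈ closedNbhd H v
  · obtain ⟨x, h1, h2⟩ := hd
    have := isolates_isolate (C := C) (v := v) (H := H)
    rwa [Isolates, ← hu.closedNbhd_eq hv h1 h2] at this ⊢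
  · push Not at hd
    intro x hx y
    constructor
    · rintro (⟨-, h2, -⟩ | ⟨-, -, h3⟩)
      · exact absurd h2 (hd x hx)
      · exact (h x hx y).1 h3
    · rintro ⟨h1, h2⟩
      exact Or.inr ⟨hd x hx, hd y h2, (h x hx y).2 ⟨h1, h2⟩⟩

/-- Let K be the good clique and A ⊆ K the part of v in C. If A = K, no edge of C is given up.
Otherwise the |A||K \ A| ≥ |K| - 1 edges between A and K \ A are regained, while only edges of the
cut of K can be newly lost, and these are fewer. -/
theorem card_missing_isolate_le (hle : C ≤ H) (hC : IsCluster C) (hv : Good H v) :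
    #(missing H (isolate C (closedNbhd H v))) ≤ #(missing H C) := by
  set K := closedNbhd H v with hK
  set A : Finset V := {x | v = x ∨ C.Adj v x} with hA
  have hAK : A ⊆ K := by
    intro x hx
    rw [hA, mem_filter] at hx
    exact mem_closedNbhd.2 (hx.2.imp_right fun h => hle h)
  by_cases hKA : K ⊆ A
  · refine card_le_card fun p hp => ?_
    obtain ⟨x, y⟩ := p
    simp only [missing, mem_filter, mem_univ, true_and] at hp ⊢
    refine ⟨hp.1, fun hc => hp.2 ?_⟩
    have inside : ∀ {x y}, C.Adj x y → x ∈ K → y ∈ K := by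
      intro x y hc hx
      have := hKA hx
      rw [hA, mem_filter] at this
      rcases this.2 with rfl | h
      · exact mem_closedNbhd.2 (Or.inr (hle hc))
      · by_cases hvy : v = y
        · exact mem_closedNbhd.2 (Or.inl hvy)
        · exact mem_closedNbhd.2 (Or.inr (hle (hC h hc hvy)))
    by_cases hx : x ∈ K
    · exact Or.inl ⟨hc.ne, hx, inside hc hx⟩
    · exact Or.inr ⟨hx, fun hy => hx (inside hc.symm hy), hc⟩
  · set X : Finset (V × V) := {p | p.1 ∈ K ∧ p.2 ∉ K ∧ H.Adj p.1 p.2} with hX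
    have hXc : #X = cut H K := rfl
    -- The pairs in M are regained; only pairs in X or its mirror image can be newly lost.
    set M := A ×ˢ (K \ A) ∪ (K \ A) ×ˢ A with hM
    have hMc : #M = 2 * (#A * #(K \ A)) := by
      rw [hM, card_union_of_disjoint, card_product, card_product]
      · ring
      · rw [disjoint_left]
        rintro ⟨x, y⟩ h1 h2
        simp only [mem_product, mem_sdiff] at h1 h2
        exact h2.1.2 h1.1
    have notC : ∀ {x y}, x ∈ A → y ∈ K \ A → ¬ C.Adj x y := by
      intro x y hx hy hc
      simp only [hA, mem_sdiff, mem_filter, mem_univ, true_and, not_or] at hx hy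
      rcases hx with rfl | h
      · exact hy.2.2 hc
      · exact hy.2.2 (hC h hc hy.2.1)
    have adjH : ∀ {x y}, x ∈ A → y ∈ K \ A → H.Adj x y := by
      intro x y hx hy
      rw [mem_sdiff] at hy
      exact (hv.1 x (hAK hx) y hy.1).resolve_left fun h => hy.2 (h ▸ hx)
    have hMs : M ⊆ missing H C := by
      rintro ⟨x, y⟩ h
      simp only [hM, mem_union, mem_product] at h
      simp only [missing, mem_filter, mem_univ, true_and]
      rcases h with ⟨hx, hy⟩ | ⟨hx, hy⟩
      · exact ⟨adjH hx hy, notC hx hy⟩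
      · exact ⟨(adjH hy hx).symm, fun h => notC hy hx h.symm⟩
    have hsub : missing H (isolate C K) ⊆ (missing H C \ M) ∪ (X ∪ X.map (Equiv.prodComm V V)) := by
      rintro ⟨x, y⟩ h
      simp only [missing, mem_filter, mem_univ, true_and] at h
      obtain ⟨h1, h2⟩ := h
      have h3 : ¬ (x ∈ K ∧ y ∈ K) := fun h => h2 (Or.inl ⟨h1.ne, h⟩)
      have h4 : (x, y) ∉ M := by
        simp only [hM, mem_union, mem_product, mem_sdiff]
        rintro (h | h)
        · exact h3 ⟨hAK h.1, h.2.1⟩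
        · exact h3 ⟨h.1.1, hAK h.2⟩
      by_cases hc : C.Adj x y
      · have h5 : x ∈ K ∨ y ∈ K := by
          by_contra! h5
          exact h2 (Or.inr ⟨h5.1, h5.2, hc⟩)
        refine mem_union_right _ ?_
        rcases h5 with h5 | h5
        · exact mem_union_left _ (mem_filter.2 ⟨mem_univ _, h5, fun h => h3 ⟨h5, h⟩, h1⟩)
        · refine mem_union_right _ (mem_map.2 ⟨(y, x), ?_, rfl⟩)
          exact mem_filter.2 ⟨mem_univ _, h5, fun h => h3 ⟨h, h5⟩, h1.symm⟩
      · refine mem_union_left _ (mem_sdiff.2 ⟨?_, h4⟩)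
        exact mem_filter.2 ⟨mem_univ _, h1, hc⟩
    have h1 := (card_le_card hsub).trans (card_union_le _ _)
    have h2 := card_union_le X (X.map (Equiv.prodComm V V).toEmbedding)
    rw [card_map] at h2
    rw [card_sdiff_of_subset hMs] at h1
    have h3 := card_le_card hMs
    have h4 : 0 < #A := card_pos.2 ⟨v, by simp [hA]⟩
    have h5 : 0 < #(K \ A) := card_pos.2 (sdiff_nonempty.2 hKA)
    have h6 := card_sdiff_add_card_eq_card hAK
    have h7 : cut H K ≤ #A * #(K \ A) := by
      rcases hv.2 with h | h
      · rw [h]; exact Nat.zero_le _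
      · rw [← hK] at h
        -- For positive factors, |A||K \ A| ≥ |A| + |K \ A| - 1 = |K| - 1.
        nlinarith
    omega

/-- Some optimal solution isolates all good cliques. -/
theorem exists_isolates (hle : C ≤ H) (hC : IsCluster C) :
    ∃ C' ≤ H, IsCluster C' ∧ #(missing H C') ≤ #(missing H C) ∧
      ∀ v, Good H v → Isolates H C' v := by
  -- The cliques are isolated one by one; by `Isolates.isolate`, later steps preserve the earlier
  -- ones.
  suffices h : ∀ S : Finset V, (∀ v ∈ S, Good H v) → ∃ C' ≤ H, IsCluster C' ∧
      #(missing H C') ≤ #(missing H C) ∧ ∀ v ∈ S, Isolates H C' v by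
    obtain ⟨C', h1, h2, h3, h4⟩ := h {v | Good H v} (by simp)
    exact ⟨C', h1, h2, h3, by simpa using h4⟩
  intro S
  induction S using Finset.induction_on with
  | empty => exact fun _ => ⟨C, hle, hC, le_rfl, by simp⟩
  | insert v S _ ih =>
    intro hS
    have hv := hS v (mem_insert_self _ _)
    have hS' := fun u hu => hS u (mem_insert_of_mem hu)
    obtain ⟨C', h1, h2, h3, h4⟩ := ih hS'
    refine ⟨isolate C' (closedNbhd H v), isolate_le h1 hv, h2.isolate _,
      (card_missing_isolate_le h1 h2 hv).trans h3, fun u hu => ?_⟩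
    rcases mem_insert.1 hu with rfl | hu
    · exact isolates_isolate
    · exact (h4 u hu).isolate (hS' u hu) hv

theorem Same.trans {z : V} (h1 : Same H x y) (h2 : Same H y z) : Same H x z := by
  obtain ⟨u, hu, hx, hy⟩ := h1
  obtain ⟨v, hv, hy', hz⟩ := h2
  exact ⟨u, hu, hx, hu.closedNbhd_eq hv hy hy' ▸ hz⟩

theorem Same.left (h : Same H x y) : Same H x x := h.trans h.symm

theorem lost_subset_missing (hC : ∀ v, Good H v → Isolates H C v) : lost H ⊆ missing H C := by
  rintro ⟨x, y⟩ h
  simp only [lost, missing, mem_filter, mem_univ, true_and] at h ⊢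
  obtain ⟨h1, h2, h3⟩ := h
  have key : ∀ {x y}, Same H x x → C.Adj x y → Same H x y := by
    rintro x y ⟨v, hv, hx, -⟩ hc
    exact ⟨v, hv, hx, ((hC v hv x hx y).1 hc).2⟩
  refine ⟨h1, fun hc => h3 ?_⟩
  rcases h2 with h2 | h2
  · exact key h2 hc
  · exact (key h2 hc.symm).symm

/-- Removing the good cliques is safe. -/
theorem hasDeletion_iff {k c : ℕ} (hc : #(lost H) = 2 * c) :
    HasDeletion H k ↔ c ≤ k ∧ HasDeletion (residual H) (k - c) := by
  constructor
  · rintro ⟨C, hle, hC, hk⟩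
    obtain ⟨D, hle, hD, hDC, hiso⟩ := exists_isolates hle hC
    -- Every lost pair meets a good clique and no residual pair does, so the two contributions to
    -- the deletions add up.
    have hsub : lost H ∪ missing (residual H) (D ⊓ residual H) ⊆ missing H D := by
      refine union_subset (lost_subset_missing hiso) ?_
      rintro ⟨x, y⟩ h
      simp only [missing, mem_filter, mem_univ, true_and, SimpleGraph.inf_adj] at h ⊢
      exact ⟨h.1.1, fun h' => h.2 ⟨h', h.1⟩⟩
    have hdisj : Disjoint (lost H) (missing (residual H) (D ⊓ residual H)) := by
      rw [disjoint_left]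
      rintro ⟨x, y⟩ h1 h2
      simp only [lost, missing, mem_filter, mem_univ, true_and] at h1 h2
      exact h1.2.1.elim h2.1.2.1 h2.1.2.2
    have := card_le_card hsub
    rw [card_union_of_disjoint hdisj] at this
    refine ⟨by omega, D ⊓ residual H, inf_le_right, ?_, by omega⟩
    intro a b c hab hbc hac
    have h := hD hab.1 hbc.1 hac
    exact ⟨h, hle h, hab.2.2.1, hbc.2.2.2⟩
  · rintro ⟨hck, D, hle, hD, hk⟩
    -- All good cliques together with the residual solution. No edge of D meets a good clique, so
    -- transitivity can be checked separately.
    let C : SimpleGraph V :=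
      { Adj := fun x y => (x ≠ y ∧ Same H x y) ∨ D.Adj x y
        symm := ⟨fun x y h => h.imp (fun h => ⟨h.1.symm, h.2.symm⟩) fun h => h.symm⟩
        loopless := ⟨fun x h => h.elim (fun h => h.1 rfl) fun h => h.ne rfl⟩ }
    refine ⟨C, ?_, ?_, ?_⟩
    · rintro x y (⟨h1, v, hv, hx, hy⟩ | h)
      · exact (hv.1 x hx y hy).resolve_left h1
      · exact (hle h).1
    · rintro x y z (⟨h1, h2⟩ | h) (⟨h1', h2'⟩ | h') hxz
      · exact Or.inl ⟨hxz, h2.trans h2'⟩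
      · exact absurd h2.symm.left (hle h').2.1
      · exact absurd h2'.left (hle h).2.2
      · exact Or.inr (hD h h' hxz)
    · have hsub : missing H C ⊆ lost H ∪ missing (residual H) D := by
        rintro ⟨x, y⟩ h
        simp only [lost, missing, mem_filter, mem_univ, true_and, mem_union, C, not_or,
          not_and] at h ⊢
        obtain ⟨h1, h2, h3⟩ := h
        by_cases hs : Same H x x ∨ Same H y y
        · exact Or.inl ⟨h1, hs, h2 h1.ne⟩
        · rw [not_or] at hs
          exact Or.inr ⟨⟨h1, hs⟩, h3⟩
      have := (card_le_card hsub).trans (card_union_le _ _)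
      omega

/-! ### Counting the vertices outside the good cliques -/

/-- The part of `x` in the partition given by the cluster graph `C`. -/
noncomputable def part (C : SimpleGraph V) (x : V) : Finset V := {y | x = y ∨ C.Adj x y}

theorem IsCluster.part_eq_iff (hC : IsCluster C) : part C y = part C x ↔ y ∈ part C x := by
  constructor
  · intro h
    rw [← h]
    simp [part]
  · intro h
    simp only [part, mem_filter, mem_univ, true_and] at h
    rcases h with rfl | h
    · rfl
    · ext z
      simp only [part, mem_filter, mem_univ, true_and]
      constructor
      · rintro (rfl | h')
        · exact Or.inr h
        · by_cases hz : x = z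
          · exact Or.inl hz
          · exact Or.inr (hC h h' hz)
      · rintro (rfl | h')
        · exact Or.inr h.symm
        · by_cases hz : y = z
          · exact Or.inl hz
          · exact Or.inr (hC h.symm h' hz)

theorem card_missing_eq_sum : #(missing H C) = ∑ x, #{y | H.Adj x y ∧ ¬ C.Adj x y} := by
  rw [missing, ← univ_product_univ, card_filter, sum_product]
  exact sum_congr rfl fun x _ => (card_filter _ _).symm

/-- The parts of a solution that are not good cliques are small compared with their cuts. -/
theorem card_part_le (hle : C ≤ H) (hC : IsCluster C) (x : V) :
    #{y ∈ part C x | ¬ Same H y y} ≤ 2 * ∑ y ∈ part C x, #{z | H.Adj y z ∧ ¬ C.Adj y z} := by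
  by_cases ht : ∀ y ∈ part C x, 0 < #{z | H.Adj y z ∧ ¬ C.Adj y z}
  · have := card_nsmul_le_sum (part C x) (fun y => #{z | H.Adj y z ∧ ¬ C.Adj y z}) 1 ht
    have := card_filter_le (part C x) fun y => ¬ Same H y y
    simp at *
    omega
  push Not at ht
  -- Since v loses no edge, its closed neighborhood in H is its whole part.
  obtain ⟨v, hv, h0⟩ := ht
  have hN : closedNbhd H v = part C x := by
    rw [← hC.part_eq_iff] at hv
    rw [← hv]
    ext z
    rw [Nat.le_zero, card_eq_zero, filter_eq_empty_iff] at h0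
    simp only [mem_closedNbhd, part, mem_filter, mem_univ, true_and]
    refine or_congr_right ⟨fun h => ?_, fun h => hle h⟩
    by_contra hc
    exact h0 (mem_univ z) ⟨h, hc⟩
  by_cases hg : Good H v
  · have : #{y ∈ part C x | ¬ Same H y y} = 0 := by
      rw [card_eq_zero, filter_eq_empty_iff]
      intro y hy
      rw [← hN] at hy
      exact not_not.2 ⟨v, hg, hy, hy⟩
    omega
  · have hcl : ∀ y ∈ closedNbhd H v, ∀ z ∈ closedNbhd H v, y = z ∨ H.Adj y z := by
      intro y hy z hz
      rw [hN] at hy hz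
      rw [← hC.part_eq_iff.2 hy] at hz
      simp only [part, mem_filter, mem_univ, true_and] at hz
      exact hz.imp_right fun h => hle h
    have hcut : cut H (part C x) ≤ ∑ y ∈ part C x, #{z | H.Adj y z ∧ ¬ C.Adj y z} := by
      rw [← card_sigma]
      refine card_le_card_of_injOn (fun p => ⟨p.1, p.2⟩) ?_ ?_
      · rintro ⟨y, z⟩ h
        simp only [coe_filter, mem_univ, true_and, Set.mem_ofPred_eq] at h
        simp only [coe_sigma, Set.mem_sigma_iff, mem_coe, mem_filter, mem_univ, true_and]
        refine ⟨h.1, h.2.2, fun hc => h.2.1 ?_⟩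
        rw [← hC.part_eq_iff.2 h.1]
        simp [part, hc]
      · rintro ⟨y, z⟩ - ⟨y', z'⟩ - h
        simpa using h
    -- Failing to be good means that the cut is nonzero and the size at most cut + 1, hence at most
    -- 2 · cut. This is the source of the factor 2.
    have h1 : ¬ (cut H (part C x) = 0 ∨ cut H (part C x) + 2 ≤ #(part C x)) := by
      rw [← hN]
      exact fun h => hg ⟨hcl, h⟩
    have := card_filter_le (part C x) fun y => ¬ Same H y y
    omega

/-- A yes-instance has few vertices outside the good cliques. -/
theorem HasDeletion.card_le {k : ℕ} (h : HasDeletion H k) : #{x | ¬ Same H x x} ≤ 4 * k := by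
  obtain ⟨C, hle, hC, hk⟩ := h
  have key : #{x | ¬ Same H x x} ≤ 2 * #(missing H C) := by
    rw [card_missing_eq_sum, card_filter,
      ← sum_fiberwise_of_maps_to (g := part C) (t := univ.image (part C)) (by simp),
      ← sum_fiberwise_of_maps_to (g := part C) (t := univ.image (part C)) (by simp), mul_sum]
    refine sum_le_sum fun K hK => ?_
    obtain ⟨x, -, rfl⟩ := mem_image.1 hK
    have : ({y | part C y = part C x} : Finset V) = part C x := by
      ext y
      simp [hC.part_eq_iff]
    rw [this, ← card_filter]
    exact card_part_le hle hC x
  omega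

/-! ### From cluster deletion back to paw-free completion -/

/-- The vertices outside the support do not matter. -/
theorem HasDeletion.of_partial_iso {W : Type*} [Fintype W] {A : SimpleGraph V} {B : SimpleGraph W}
    {k : ℕ} (h : HasDeletion A k) (g : W → V) (S : Set W) (hg : Set.InjOn g S)
    (hS : ∀ i j, B.Adj i j ↔ i ∈ S ∧ j ∈ S ∧ A.Adj (g i) (g j)) : HasDeletion B k := by
  obtain ⟨C, hle, hC, hk⟩ := h
  -- Outside S the map g may identify vertices; intersecting with B, which has no edges there,
  -- discards what `comap` produces.
  refine ⟨B ⊓ C.comap g, inf_le_left, ?_, ?_⟩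
  · rintro a b c ⟨h1, h2⟩ ⟨h1', h2'⟩ hac
    have ha := ((hS _ _).1 h1).1
    have hc := ((hS _ _).1 h1').2.1
    have := hC h2 h2' fun h => hac (hg ha hc h)
    exact ⟨(hS _ _).2 ⟨ha, hc, hle this⟩, this⟩
  · refine (card_le_card_of_injOn (fun p => (g p.1, g p.2)) ?_ ?_).trans hk
    · rintro ⟨i, j⟩ h
      simp only [missing, coe_filter, mem_univ, true_and, Set.mem_ofPred_eq, SimpleGraph.inf_adj,
        SimpleGraph.comap_adj, not_and] at h ⊢
      exact ⟨((hS _ _).1 h.1).2.2, h.2 h.1⟩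
    · rintro ⟨i, j⟩ h ⟨i', j'⟩ h' he
      simp only [missing, coe_filter, mem_univ, true_and, Set.mem_ofPred_eq] at h h'
      have h := (hS _ _).1 h.1
      have h' := (hS _ _).1 h'.1
      simp only [Prod.mk.injEq] at he ⊢
      exact ⟨hg h.1 h'.1 he.1, hg h.2.1 h'.2.1 he.2⟩

/-- If `u` is adjacent to all other vertices, the obstructions are the missing edges. -/
theorem hasDeletion_obstruction_iff {G : SimpleGraph V} {k : ℕ} (hu : ∀ x, x ≠ u → G.Adj u x) :
    HasDeletion (obstruction G) k ↔ HasDeletion Gᶜ k := by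
  by_cases ht : ∃ x y, x ≠ u ∧ y ≠ u ∧ G.Adj x y
  -- An edge that avoids u forms a triangle with u, and u makes the graph connected.
  · obtain ⟨x, y, hx, hy, hxy⟩ := ht
    have hr : ∀ v, G.Reachable u v := by
      intro v
      by_cases hv : v = u
      · subst hv; rfl
      · exact (hu v hv).reachable
    have : obstruction G = Gᶜ := by
      ext a b
      rw [obstruction_adj, SimpleGraph.compl_adj]
      refine ⟨fun h => ⟨h.1, h.2.1⟩, fun h => ⟨h.1, h.2, (hr a).symm.trans (hr b), u, x, y,
        (hr a).symm, hu x hx, hxy, hu y hy⟩⟩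
    rw [this]
  -- Now G is a star. Its obstruction graph is empty and its complement is a clique plus the
  -- isolated vertex u, so neither needs a deletion.
  · have triv : ∀ A : SimpleGraph V, IsCluster A → HasDeletion A k := fun A hA =>
      ⟨A, le_rfl, hA, by simp [missing]⟩
    push Not at ht
    refine iff_of_true (triv _ ?_) (triv _ ?_)
    · rintro a b c ⟨-, -, -, x, y, z, -, h1, h2, h3⟩
      by_cases hx : x = u
      · subst hx
        exact absurd h2 (ht _ _ h1.ne' h3.ne')
      · by_cases hy : y = u
        · subst hy
          exact absurd h3 (ht _ _ hx h2.ne')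
        · exact absurd h1 (ht _ _ hx hy)
    · rintro a b c ⟨h1, h2⟩ ⟨h3, h4⟩ hac
      refine ⟨hac, ht _ _ ?_ ?_⟩
      · rintro rfl; exact h2 (hu _ h1.symm)
      · rintro rfl; exact h4 (hu _ h3).symm

end Kernel

section Output

open scoped Classical

variable {n : ℕ}

/-! ## The reduced instance -/

/-- The position of `x` among the vertices outside the good cliques. -/
noncomputable def rank (H : SimpleGraph (Fin n)) (x : Fin n) : ℕ := #{y | y < x ∧ ¬ Same H y y}

/-- The number of vertices outside the good cliques. -/
noncomputable def order (H : SimpleGraph (Fin n)) : ℕ := #{y | ¬ Same H y y}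

/-- The number of edges lost when the good cliques are removed. -/
noncomputable def cost (H : SimpleGraph (Fin n)) : ℕ := #{p ∈ lost H | p.1 < p.2}

/-- The complement of the residual graph, its vertices being renumbered by `rank`, and all other
vertices being adjacent to everything. -/
def outGraph (H : SimpleGraph (Fin n)) (N : ℕ) : SimpleGraph (Fin N) where
  Adj i j := i ≠ j ∧ ¬ ∃ x y, ¬ Same H x x ∧ ¬ Same H y y ∧ rank H x = i ∧ rank H y = j ∧ H.Adj x y
  symm := ⟨by
    rintro i j ⟨h1, h2⟩
    exact ⟨h1.symm, fun ⟨x, y, hx, hy, hi, hj, h⟩ => h2 ⟨y, x, hy, hx, hj, hi, h.symm⟩⟩⟩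
  loopless := ⟨fun _ h => h.1 rfl⟩

/-- The kernel rejects the instance: the good cliques or the other vertices are too many. -/
def Reject (I : Instance) : Prop :=
  I.k < cost (obstruction I.G) ∨ 4 * I.k < order (obstruction I.G)

/-- The number of vertices of the kernel of an instance that is not rejected. -/
noncomputable def kernelOrder (I : Instance) : ℕ :=
  -- Without this case, an accepted instance with k = 0 would produce one vertex and violate the
  -- bound.
  if order (obstruction I.G) = 0 then 0 else order (obstruction I.G) + 1

/-- The kernel. -/
noncomputable def kernel (I : Instance) : Instance :=
  if Reject I then ⟨4, paw, 0⟩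
  else ⟨kernelOrder I, outGraph (obstruction I.G) _, I.k - cost (obstruction I.G)⟩

/-- `lost` is closed under swapping and has no diagonal pairs, so the pairs with increasing entries
make up half of it. -/
theorem card_lost (H : SimpleGraph (Fin n)) : #(lost H) = 2 * cost H := by
  have h1 := card_filter_add_card_filter_not (s := lost H) (fun p => p.1 < p.2)
  have h2 : #{p ∈ lost H | ¬ p.1 < p.2} = cost H := by
    refine card_bij (fun p _ => (p.2, p.1)) ?_ ?_ ?_
    · rintro ⟨x, y⟩ h
      simp only [lost, mem_filter, mem_univ, true_and] at h ⊢
      refine ⟨⟨h.1.1.symm, h.1.2.1.symm, fun hs => h.1.2.2 hs.symm⟩, ?_⟩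
      exact lt_of_le_of_ne (not_lt.1 h.2) h.1.1.ne'
    · rintro ⟨x, y⟩ - ⟨x', y'⟩ - h
      simp only [Prod.mk.injEq] at h ⊢
      exact h.symm
    · rintro ⟨x, y⟩ h
      simp only [lost, mem_filter, mem_univ, true_and] at h
      refine ⟨(y, x), ?_, rfl⟩
      simp only [lost, mem_filter, mem_univ, true_and]
      exact ⟨⟨h.1.1.symm, h.1.2.1.symm, fun hs => h.1.2.2 hs.symm⟩, not_lt.2 h.2.le⟩
  rw [cost] at *
  omega

theorem rank_lt_rank {H : SimpleGraph (Fin n)} {x y : Fin n} (hx : ¬ Same H x x) (h : x < y) :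
    rank H x < rank H y := by
  refine card_lt_card ⟨fun z hz => ?_, fun hs => ?_⟩
  · simp only [mem_filter, mem_univ, true_and] at hz ⊢
    exact ⟨hz.1.trans h, hz.2⟩
  · have := hs (mem_filter.2 ⟨mem_univ x, h, hx⟩)
    simp at this

theorem rank_injOn (H : SimpleGraph (Fin n)) : Set.InjOn (rank H) {x | ¬ Same H x x} := by
  intro x hx y hy h
  rcases lt_trichotomy x y with h' | h' | h'
  · exact absurd h (rank_lt_rank hx h').ne
  · exact h'
  · exact absurd h (rank_lt_rank hy h').ne'

theorem rank_lt {H : SimpleGraph (Fin n)} {x : Fin n} (hx : ¬ Same H x x) : rank H x < order H := by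
  refine card_lt_card ⟨fun z hz => ?_, fun hs => ?_⟩
  · simp only [mem_filter, mem_univ, true_and] at hz ⊢
    exact hz.2
  · have := hs (mem_filter.2 ⟨mem_univ x, hx⟩)
    simp at this

theorem exists_rank_eq {H : SimpleGraph (Fin n)} {i : ℕ} (hi : i < order H) :
    ∃ x, ¬ Same H x x ∧ rank H x = i := by
  have h : ({y | ¬ Same H y y} : Finset (Fin n)).image (rank H) = range (order H) := by
    refine eq_of_subset_of_card_le ?_ ?_
    · intro j hj
      obtain ⟨x, hx, rfl⟩ := mem_image.1 hj
      exact mem_range.2 (rank_lt (mem_filter.1 hx).2)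
    · rw [card_image_of_injOn, card_range, order]
      intro x hx y hy
      simp only [coe_filter, mem_univ, true_and] at hx hy
      exact rank_injOn H hx hy
  have := mem_range.2 hi
  rw [← h] at this
  obtain ⟨x, hx, rfl⟩ := mem_image.1 this
  exact ⟨x, (mem_filter.1 hx).2, rfl⟩

/-- The number `order H` is not a rank, so the last vertex is universal and
`hasDeletion_obstruction_iff` applies. The map `rank` and its inverse are then partial isomorphisms
between the complement and the residual graph. -/
theorem hasDeletion_outGraph_iff {H : SimpleGraph (Fin n)} (h0 : order H ≠ 0) (k : ℕ) :
    HasDeletion (obstruction (outGraph H (order H + 1))) k ↔ HasDeletion (residual H) k := by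
  have hadj : ∀ i j, (outGraph H (order H + 1))ᶜ.Adj i j ↔
      ∃ x y, ¬ Same H x x ∧ ¬ Same H y y ∧ rank H x = i ∧ rank H y = j ∧ H.Adj x y := by
    intro i j
    rw [SimpleGraph.compl_adj]
    constructor
    · rintro ⟨h1, h2⟩
      by_contra h
      exact h2 ⟨h1, h⟩
    · rintro ⟨x, y, hx, hy, hi, hj, h⟩
      refine ⟨?_, fun h' => h'.2 ⟨x, y, hx, hy, hi, hj, h⟩⟩
      rintro rfl
      exact h.ne (rank_injOn H hx hy (hi.trans hj.symm))
  rw [hasDeletion_obstruction_iff (u := Fin.last (order H))]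
  · constructor
    · intro h
      refine h.of_partial_iso (fun x => Fin.ofNat _ (rank H x)) {x | ¬ Same H x x} ?_ ?_
      · intro x hx y hy h
        refine rank_injOn H hx hy ?_
        have := congrArg Fin.val h
        simpa [Nat.mod_eq_of_lt ((rank_lt hx).trans (Nat.lt_succ_self _)),
          Nat.mod_eq_of_lt ((rank_lt hy).trans (Nat.lt_succ_self _))] using this
      · intro x y
        rw [hadj]
        constructor
        · rintro ⟨h, hx, hy⟩
          exact ⟨hx, hy, x, y, hx, hy,
            (Nat.mod_eq_of_lt ((rank_lt hx).trans (Nat.lt_succ_self _))).symm,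
            (Nat.mod_eq_of_lt ((rank_lt hy).trans (Nat.lt_succ_self _))).symm, h⟩
        · rintro ⟨hx, hy, x', y', hx', hy', h1, h2, h⟩
          simp only [Fin.val_ofNat, Nat.mod_eq_of_lt ((rank_lt hx).trans (Nat.lt_succ_self _)),
            Nat.mod_eq_of_lt ((rank_lt hy).trans (Nat.lt_succ_self _))] at h1 h2
          rw [rank_injOn H hx' hx h1, rank_injOn H hy' hy h2] at h
          exact ⟨h, hx, hy⟩
    · intro h
      -- A dummy image for the universal vertex, which lies outside the support; it exists because
      -- `order H` is nonzero.
      obtain ⟨x₀, -⟩ := exists_rank_eq (Nat.pos_of_ne_zero h0)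
      have hex : ∀ i : Fin (order H + 1), ∃ x, (i : ℕ) < order H → ¬ Same H x x ∧ rank H x = i := by
        intro i
        by_cases hi : (i : ℕ) < order H
        · obtain ⟨x, hx⟩ := exists_rank_eq hi
          exact ⟨x, fun _ => hx⟩
        · exact ⟨x₀, fun h => absurd h hi⟩
      choose g hg using hex
      refine h.of_partial_iso g {i | (i : ℕ) < order H} ?_ ?_
      · intro i hi j hj h
        exact Fin.ext ((hg i hi).2.symm.trans ((congrArg _ h).trans (hg j hj).2))
      · intro i j
        rw [hadj]
        constructor
        · rintro ⟨x, y, hx, hy, hi, hj, h⟩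
          have hi' : (i : ℕ) < order H := hi ▸ rank_lt hx
          have hj' : (j : ℕ) < order H := hj ▸ rank_lt hy
          refine ⟨hi', hj', ?_⟩
          rw [rank_injOn H (hg i hi').1 hx ((hg i hi').2.trans hi.symm),
            rank_injOn H (hg j hj').1 hy ((hg j hj').2.trans hj.symm)]
          exact ⟨h, hx, hy⟩
        · rintro ⟨hi, hj, h, hx, hy⟩
          exact ⟨g i, g j, hx, hy, (hg i hi).2, (hg j hj).2, h⟩
  · intro x hx
    refine ⟨hx.symm, ?_⟩
    rintro ⟨y, -, hy, -, h, -⟩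
    have := rank_lt hy
    simp at h
    omega

theorem not_isYes_paw : ¬ Instance.IsYes ⟨4, paw, 0⟩ := by
  rintro ⟨E, -, hE, h⟩
  simp only [Nat.le_zero, card_eq_zero] at hE
  subst hE
  simp only [coe_empty, SimpleGraph.fromEdgeSet_empty, sup_bot_eq] at h
  exact h ⟨.refl⟩

theorem Reject.not_isYes {I : Instance} (h : Reject I) : ¬ I.IsYes := by
  rw [I.isYes_iff]
  intro hd
  rcases h with h | h
  · exact absurd ((hasDeletion_iff (card_lost _)).1 hd).1 (not_le.2 h)
  · exact absurd hd.card_le (not_le.2 h)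

theorem kernel_isYes_iff (I : Instance) : (kernel I).IsYes ↔ I.IsYes := by
  unfold kernel
  split_ifs with h
  · exact iff_of_false not_isYes_paw h.not_isYes
  · rw [Reject, not_or, not_lt, not_lt] at h
    rw [Instance.isYes_iff, I.isYes_iff, hasDeletion_iff (card_lost (obstruction I.G)),
      and_iff_right h.1]
    dsimp only
    by_cases h0 : order (obstruction I.G) = 0
    · have hN : kernelOrder I = 0 := if_pos h0
      refine iff_of_true ⟨_, le_rfl, fun a => (Fin.cast hN a).elim0, by simp [missing]⟩
        ⟨_, le_rfl, ?_, by simp [missing]⟩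
      rw [order, card_eq_zero, filter_eq_empty_iff] at h0
      exact fun a b c h => absurd h.2.1 (h0 (mem_univ a))
    · have hN : kernelOrder I = order (obstruction I.G) + 1 := if_neg h0
      rw [hN]
      exact hasDeletion_outGraph_iff h0 _

theorem kernel_k_le (I : Instance) : (kernel I).k ≤ I.k := by
  unfold kernel
  split_ifs with h <;> simp

theorem kernel_n_le (I : Instance) :
    (kernel I).n ≤ 38 * I.k ∨ (I.k = 0 ∧ ¬ I.IsYes ∧ (kernel I).n = 4) := by
  unfold kernel
  split_ifs with h
  · rcases Nat.eq_zero_or_pos I.k with hk | hk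
    · exact Or.inr ⟨hk, h.not_isYes, rfl⟩
    · left; change 4 ≤ _; omega
  · left
    rw [Reject, not_or, not_lt, not_lt] at h
    change kernelOrder I ≤ _
    rw [kernelOrder]
    -- A nonzero order that is at most 4k forces k ≥ 1, so order + 1 ≤ 5k.
    split_ifs with h0 <;> omega

end Output

/-! ## Running programs -/

/-- The program `p`, started in `s`, halts within `B` steps in a configuration that satisfies `Q`. -/
def Runs (p : Prog) (B : ℕ) (s : State) (Q : State → Prop) : Prop :=
  ∃ t s', Exec p s t s' ∧ t ≤ B ∧ Q s'

theorem Runs.mono {p : Prog} {B B' : ℕ} {s : State} {Q Q' : State → Prop} (h : Runs p B s Q)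
    (hB : B ≤ B') (hQ : ∀ s', Q s' → Q' s') : Runs p B' s Q' := by
  obtain ⟨t, s', h1, h2, h3⟩ := h
  exact ⟨t, s', h1, h2.trans hB, hQ _ h3⟩

theorem Runs.seq {p q : Prog} {B B' : ℕ} {s : State} {Q Q' : State → Prop} (h : Runs p B s Q)
    (h' : ∀ s', Q s' → Runs q B' s' Q') : Runs (.seq p q) (B + B') s Q' := by
  obtain ⟨t, s', h1, h2, h3⟩ := h
  obtain ⟨t', s'', h4, h5, h6⟩ := h' s' h3
  exact ⟨t + t', s'', .seq h1 h4, add_le_add h2 h5, h6⟩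

theorem runs_assign (x : ℕ) (e : Expr) (s : State) :
    Runs (.assign x e) (e.cost + 1) s (· = s.setVar x (e.eval s)) :=
  ⟨_, _, .assign x e s, le_rfl, rfl⟩

theorem runs_store (a : ℕ) (e₁ e₂ e : Expr) (s : State) :
    Runs (.store a e₁ e₂ e) (e₁.cost + e₂.cost + e.cost + 1) s
      (· = s.setArr a (e₁.eval s) (e₂.eval s) (e.eval s)) :=
  ⟨_, _, .store a e₁ e₂ e s, le_rfl, rfl⟩

/-- The test evaluates to the number of rounds left, so there are exactly N of them; the induction
is on that number. -/
theorem runs_loop {e : Expr} {p : Prog} {N B : ℕ} {Inv : ℕ → State → Prop}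
    (he : ∀ i s, Inv i s → e.eval s = N - i)
    (hp : ∀ i < N, ∀ s, Inv i s → Runs p B s (Inv (i + 1))) {s : State} (hs : Inv 0 s) :
    Runs (.loop e p) (N * (e.cost + 1 + B) + (e.cost + 1)) s (Inv N) := by
  suffices h : ∀ m ≤ N, ∀ s, Inv (N - m) s →
      Runs (.loop e p) (m * (e.cost + 1 + B) + (e.cost + 1)) s (Inv N) from
    h N le_rfl s (by simpa using hs)
  intro m
  induction m with
  | zero =>
    intro _ s hs
    have := he _ _ hs
    exact ⟨_, s, .loop_false (by simpa using this), by simp, by simpa using hs⟩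
  | succ m ih =>
    intro hm s hs
    have h0 : e.eval s ≠ 0 := by rw [he _ _ hs]; omega
    obtain ⟨t, s', h1, h2, h3⟩ := hp _ (by omega) s hs
    rw [show N - (m + 1) + 1 = N - m by omega] at h3
    obtain ⟨t', s'', h4, h5, h6⟩ := ih (by omega) s' h3
    refine ⟨_, s'', .loop_true h0 h1 h4, ?_, h6⟩
    rw [add_mul]
    omega

@[simp] theorem State.setVar_var_self (s : State) (x v : ℕ) : (s.setVar x v).var x = v := by
  simp [State.setVar]

theorem State.setVar_var_of_ne (s : State) {x y : ℕ} (v : ℕ) (h : y ≠ x) :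
    (s.setVar x v).var y = s.var y := by
  simp [State.setVar, h]

@[simp] theorem State.setVar_arr (s : State) (x v : ℕ) : (s.setVar x v).arr = s.arr := rfl

@[simp] theorem State.setArr_var (s : State) (a i j v : ℕ) : (s.setArr a i j v).var = s.var := rfl

/-! ## Terms with bounded sums -/

/-- Terms: the expressions of the machine, with case distinctions and sums. The variable `x` of
`sum x t` runs over the numbers below the value of variable `0`. -/
inductive Term where
  | const (c : ℕ)
  | var (x : ℕ)
  | get (a : ℕ) (t u : Term)
  | add (t u : Term)
  | sub (t u : Term)
  | ite (c t u : Term)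
  | sum (x : ℕ) (t : Term)

namespace Term

/-- The value of a term. -/
def eval : Term → State → ℕ
  | .const c, _ => c
  | .var x, s => s.var x
  | .get a t u, s => s.arr a (t.eval s) (u.eval s)
  | .add t u, s => t.eval s + u.eval s
  | .sub t u, s => t.eval s - u.eval s
  | .ite c t u, s => if c.eval s ≠ 0 then t.eval s else u.eval s
  | .sum x t, s => ∑ i ∈ range (s.var 0), t.eval (s.setVar x i)

/-- All variables of the term are below `d`, and variable `0` is not bound by a sum. -/
def Below (d : ℕ) : Term → Prop
  | .const _ => True
  | .var x => x < d
  | .get _ t u => t.Below d ∧ u.Below d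
  | .add t u => t.Below d ∧ u.Below d
  | .sub t u => t.Below d ∧ u.Below d
  | .ite c t u => c.Below d ∧ t.Below d ∧ u.Below d
  | .sum x t => x ≠ 0 ∧ x < d ∧ t.Below d

/-- The term does not read array `a`. -/
def Avoids (a : ℕ) : Term → Prop
  | .const _ => True
  | .var _ => True
  | .get b t u => b ≠ a ∧ t.Avoids a ∧ u.Avoids a
  | .add t u => t.Avoids a ∧ u.Avoids a
  | .sub t u => t.Avoids a ∧ u.Avoids a
  | .ite c t u => c.Avoids a ∧ t.Avoids a ∧ u.Avoids a
  | .sum _ t => t.Avoids a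

/-- The array a is exempt when t does not read it, which is what allows `fill` to overwrite it while
evaluating. Variable `0` must lie below d because it is the range of every sum. -/
theorem eval_congr {d a : ℕ} (t : Term) (ht : t.Below d) (hd : 0 < d) {s s' : State}
    (hv : ∀ x < d, s.var x = s'.var x) (ha : t.Avoids a ∨ s.arr a = s'.arr a)
    (hb : ∀ b ≠ a, s.arr b = s'.arr b) :
    t.eval s = t.eval s' := by
  induction t generalizing s s' with
  | const c => rfl
  | var x => exact hv x ht
  | get b t u iht ihu =>
    have h : s.arr b = s'.arr b := by
      by_cases h : b = a
      · rcases ha with ha | ha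
        · exact absurd h ha.1
        · rw [h, ha]
      · exact hb b h
    simp only [eval, h, iht ht.1 hv (ha.imp_left fun h => h.2.1) hb,
      ihu ht.2 hv (ha.imp_left fun h => h.2.2) hb]
  | add t u iht ihu =>
    simp only [eval, iht ht.1 hv (ha.imp_left fun h => h.1) hb,
      ihu ht.2 hv (ha.imp_left fun h => h.2) hb]
  | sub t u iht ihu =>
    simp only [eval, iht ht.1 hv (ha.imp_left fun h => h.1) hb,
      ihu ht.2 hv (ha.imp_left fun h => h.2) hb]
  | ite c t u ihc iht ihu =>
    simp only [eval, ihc ht.1 hv (ha.imp_left fun h => h.1) hb,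
      iht ht.2.1 hv (ha.imp_left fun h => h.2.1) hb, ihu ht.2.2 hv (ha.imp_left fun h => h.2.2) hb]
  | sum x t ih =>
    simp only [eval, hv 0 hd]
    refine sum_congr rfl fun i _ => ih ht.2.2 (fun y hy => ?_) ha hb
    by_cases h : y = x
    · subst h; simp
    · simp [State.setVar_var_of_ne, h, hv y hy]

theorem Below.mono {d d' : ℕ} (h : d ≤ d') {t : Term} (ht : t.Below d) : t.Below d' := by
  induction t with
  | const c => trivial
  | var x => exact lt_of_lt_of_le ht h
  | get b t u iht ihu => exact ⟨iht ht.1, ihu ht.2⟩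
  | add t u iht ihu => exact ⟨iht ht.1, ihu ht.2⟩
  | sub t u iht ihu => exact ⟨iht ht.1, ihu ht.2⟩
  | ite c t u ihc iht ihu => exact ⟨ihc ht.1, iht ht.2.1, ihu ht.2.2⟩
  | sum x t ih => exact ⟨ht.1, lt_of_lt_of_le ht.2.1 h, ih ht.2.2⟩

/-- A program that stores the value of the term in variable `d`, using the variables above `d` as
scratch memory. -/
def compile : ℕ → Term → Prog
  | d, .const c => .assign d (.const c)
  | d, .var x => .assign d (.var x)
  | d, .get a t u => .seq (t.compile d) (.seq (u.compile (d + 1))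
      (.assign d (.get a (.var d) (.var (d + 1)))))
  | d, .add t u => .seq (t.compile d) (.seq (u.compile (d + 1))
      (.assign d (.add (.var d) (.var (d + 1)))))
  | d, .sub t u => .seq (t.compile d) (.seq (u.compile (d + 1))
      (.assign d (.sub (.var d) (.var (d + 1)))))
  | d, .ite c t u => .seq (c.compile d) (.ite (.var d) (t.compile d) (u.compile d))
  -- Variable d accumulates the sum and d + 1 saves the old value of x, which is restored at the
  -- end; the body therefore starts at d + 2.
  | d, .sum x t => .seq (.assign (d + 1) (.var x)) (.seq (.assign d (.const 0))
      (.seq (.assign x (.const 0)) (.seq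
        (.loop (.sub (.var 0) (.var x)) (.seq (t.compile (d + 2))
          (.seq (.assign d (.add (.var d) (.var (d + 2)))) (.assign x (.add (.var x) (.const 1))))))
        (.assign x (.var (d + 1))))))

/-- A polynomial bound for the running time of `Term.compile`. -/
noncomputable def time : Term → Polynomial ℕ
  | .const _ => 2
  | .var _ => 2
  | .get _ t u => t.time + u.time + 4
  | .add t u => t.time + u.time + 4
  | .sub t u => t.time + u.time + 4
  | .ite c t u => c.time + t.time + u.time + 2
  | .sum _ t => .X * (t.time + 12) + 12

/-- The effect of `Term.compile d t`. -/
def Computed (d v : ℕ) (s s' : State) : Prop :=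
  s'.var d = v ∧ (∀ x < d, s'.var x = s.var x) ∧ s'.arr = s.arr

theorem runs_binary {d v w : ℕ} {p q : Prog} {B B' : ℕ} {s : State} {e : Expr} (f : ℕ → ℕ → ℕ)
    (hp : Runs p B s (Computed d v s))
    (hq : ∀ s', Computed d v s s' → Runs q B' s' (Computed (d + 1) w s'))
    (he : ∀ s', s'.arr = s.arr → e.eval s' = f (s'.var d) (s'.var (d + 1))) :
    Runs (.seq p (.seq q (.assign d e))) (B + (B' + (e.cost + 1))) s (Computed d (f v w) s) := by
  refine hp.seq fun s₁ h₁ => (hq s₁ h₁).seq fun s₂ h₂ => (runs_assign d e s₂).mono le_rfl ?_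
  rintro s' rfl
  refine ⟨?_, fun x hx => ?_, ?_⟩
  · rw [State.setVar_var_self, he s₂ (h₂.2.2.trans h₁.2.2), h₂.1, h₂.2.1 d (by omega), h₁.1]
  · rw [State.setVar_var_of_ne _ _ hx.ne, h₂.2.1 x (by omega), h₁.2.1 x hx]
  · exact h₂.2.2.trans h₁.2.2

/-- Running a compiled subterm preserves the arrays and all variables below d, so the next subterm
still has its original value (`congr`). In a sum, the bound variable is exempt from this invariant
until it is restored after the loop. -/
theorem runs_compile {d : ℕ} (t : Term) (ht : t.Below d) (hd : 0 < d) (s : State) :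
    Runs (t.compile d) (t.time.eval (s.var 0)) s (Computed d (t.eval s) s) := by
  have congr : ∀ {d' d v : ℕ} {t : Term} {s s' : State}, t.Below d → 0 < d → d ≤ d' →
      Computed d' v s s' → t.eval s' = t.eval s := fun ht hd hd' h =>
    eval_congr (a := 0) _ ht hd (fun x hx => h.2.1 x (hx.trans_le hd')) (Or.inr (by rw [h.2.2]))
      (fun b _ => by rw [h.2.2])
  have binary : ∀ {d : ℕ} {t u : Term} {s : State} {e : Expr} (f : ℕ → ℕ → ℕ), 0 < d →
      u.Below d → Runs (t.compile d) (t.time.eval (s.var 0)) s (Computed d (t.eval s) s) →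
      (∀ s, Runs (u.compile (d + 1)) (u.time.eval (s.var 0)) s (Computed (d + 1) (u.eval s) s)) →
      (∀ s', s'.arr = s.arr → e.eval s' = f (s'.var d) (s'.var (d + 1))) → e.cost = 3 →
      Runs (.seq (t.compile d) (.seq (u.compile (d + 1)) (.assign d e)))
        ((t.time + u.time + 4).eval (s.var 0)) s (Computed d (f (t.eval s) (u.eval s)) s) := by
    intro d t u s e f hd hu h1 h2 he hc
    refine (runs_binary f h1 (B' := u.time.eval (s.var 0)) (w := u.eval s)
      (fun s' hs' => ?_) he).mono ?_ fun _ h => h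
    · have := h2 s'
      rw [congr hu hd le_rfl hs', hs'.2.1 0 hd] at this
      exact this
    · simp [hc]
      omega
  induction t generalizing d s with
  | const c =>
    refine (runs_assign d _ s).mono (by simp [Expr.cost, time]) ?_
    rintro s' rfl
    exact ⟨by simp [Expr.eval, eval], fun x hx => State.setVar_var_of_ne _ _ hx.ne, rfl⟩
  | var y =>
    refine (runs_assign d _ s).mono (by simp [Expr.cost, time]) ?_
    rintro s' rfl
    exact ⟨by simp [Expr.eval, eval], fun x hx => State.setVar_var_of_ne _ _ hx.ne, rfl⟩
  | get a t u iht ihu =>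
    refine binary (s.arr a) hd ht.2 (iht ht.1 hd s)
      (ihu (ht.2.mono (Nat.le_succ d)) (Nat.succ_pos d)) (fun s' h => ?_) rfl
    simp [Expr.eval, h]
  | add t u iht ihu =>
    exact binary (· + ·) hd ht.2 (iht ht.1 hd s)
      (ihu (ht.2.mono (Nat.le_succ d)) (Nat.succ_pos d)) (fun s' h => rfl) rfl
  | sub t u iht ihu =>
    exact binary (· - ·) hd ht.2 (iht ht.1 hd s)
      (ihu (ht.2.mono (Nat.le_succ d)) (Nat.succ_pos d)) (fun s' h => rfl) rfl
  | ite c t u ihc iht ihu =>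
    have hB : (time (.ite c t u)).eval (s.var 0) = c.time.eval (s.var 0) +
        (t.time.eval (s.var 0) + u.time.eval (s.var 0) + 2) := by
      simp [time]; ring
    rw [hB]
    refine (ihc ht.1 hd s).seq fun s₁ h₁ => ?_
    have h0 := h₁.2.1 0 hd
    have trans : ∀ {v s'}, Computed d v s₁ s' → Computed d v s s' := fun h =>
      ⟨h.1, fun x hx => (h.2.1 x hx).trans (h₁.2.1 x hx), h.2.2.trans h₁.2.2⟩
    by_cases hc : c.eval s = 0
    · obtain ⟨T, s', h2, h3, h4⟩ := ihu ht.2.2 hd s₁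
      rw [congr ht.2.2 hd le_rfl h₁] at h4
      rw [h0] at h3
      refine ⟨_, s', .ite_false (h₁.1.trans hc) h2, ?_, ?_⟩
      · simp only [Expr.cost]; omega
      · simpa [eval, hc] using trans h4
    · obtain ⟨T, s', h2, h3, h4⟩ := iht ht.2.1 hd s₁
      rw [congr ht.2.1 hd le_rfl h₁] at h4
      rw [h0] at h3
      refine ⟨_, s', .ite_true (fun h => hc (h₁.1.symm.trans h)) h2, ?_, ?_⟩
      · simp only [Expr.cost]; omega
      · simpa [eval, hc] using trans h4
  | sum x t ih =>
    obtain ⟨hx0, hxd, ht⟩ := ht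
    have hB : (time (.sum x t)).eval (s.var 0) = 2 + (2 + (2 + ((s.var 0 *
        (4 + (t.time.eval (s.var 0) + (4 + 4))) + 4) + 2))) := by
      simp [time]; ring
    rw [hB]
    refine (runs_assign _ _ s).seq ?_
    rintro _ rfl
    refine (runs_assign _ _ _).seq ?_
    rintro _ rfl
    refine (runs_assign _ _ _).seq ?_
    rintro _ rfl
    refine Runs.seq (runs_loop (N := s.var 0) (Inv := fun i s' => s'.var x = i ∧
      s'.var d = ∑ j ∈ range i, t.eval (s.setVar x j) ∧ s'.var (d + 1) = s.var x ∧
      (∀ y < d, y ≠ x → s'.var y = s.var y) ∧ s'.arr = s.arr) ?_ ?_ ?_) (Q' := Computed d _ s) ?_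
    · rintro i s' ⟨h1, h2, h3, h4, h5⟩
      simp [Expr.eval, h1, h4 0 hd hx0.symm]
    · rintro i hi s₁ ⟨h1, h2, h3, h4, h5⟩
      have hv : t.eval s₁ = t.eval (s.setVar x i) := by
        refine t.eval_congr (a := 0) ht hd (fun y hy => ?_) (Or.inr (by rw [h5]; rfl))
          fun b _ => by rw [h5]; rfl
        by_cases h : y = x
        · subst h; simp [h1]
        · simp [State.setVar_var_of_ne, h, h4 y hy h]
      have hrun := ih (d := d + 2) (ht.mono (by omega)) (by omega) s₁
      rw [h4 0 hd hx0.symm] at hrun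
      refine hrun.seq fun s₂ h₂ => ?_
      refine (runs_assign _ _ _).seq ?_
      rintro _ rfl
      refine (runs_assign _ _ _).mono le_rfl ?_
      rintro _ rfl
      obtain ⟨k1, k2, k3⟩ := h₂
      have hdx : d ≠ x := hxd.ne'
      have hdx' : d + 1 ≠ x := by omega
      refine ⟨?_, ?_, ?_, fun y hy hyx => ?_, k3.trans h5⟩
      · simp [Expr.eval, State.setVar_var_of_ne, hdx.symm, k2 x (by omega), h1]
      · simp [Expr.eval, State.setVar_var_of_ne, hdx, k1, k2 d (by omega), h2, hv, sum_range_succ]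
      · simp [State.setVar_var_of_ne, hdx', k2 (d + 1) (by omega), h3]
      · simp [State.setVar_var_of_ne, hyx, hy.ne, k2 y (by omega), h4 y hy hyx]
    · have hdx : d ≠ x := hxd.ne'
      have hdx' : d + 1 ≠ x := by omega
      refine ⟨?_, ?_, ?_, fun y hy hyx => ?_, rfl⟩
      · simp [Expr.eval]
      · simp [Expr.eval, State.setVar_var_of_ne, hdx]
      · simp [Expr.eval, State.setVar_var_of_ne, hdx']
      · simp [State.setVar_var_of_ne, hyx, hy.ne, (show y ≠ d + 1 by omega)]
    · rintro s' ⟨h1, h2, h3, h4, h5⟩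
      refine (runs_assign _ _ _).mono le_rfl ?_
      rintro _ rfl
      refine ⟨?_, fun y hy => ?_, h5⟩
      · simpa [eval, State.setVar_var_of_ne, hxd.ne'] using h2
      · by_cases h : y = x
        · subst h; simp [Expr.eval, h3]
        · simp [State.setVar_var_of_ne, h, h4 y hy h]

end Term

/-! ## Filling arrays -/

/-- A program that sets `a[i, j]` to the value of `t` at `i` and `j`, the values of the
variables `2` and `3`, for all `i` and `j` below `n + 4`, where `n` is the value of variable `0`. -/
def fill (a : ℕ) (t : Term) : Prog :=
  -- The margin 4 makes room for an output paw when the input has fewer vertices, and provides the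
  -- cell (0, 0) even if n = 0.
  .seq (.assign 2 (.const 0)) (.loop (.sub (.add (.var 0) (.const 4)) (.var 2))
    (.seq (.assign 3 (.const 0)) (.seq (.loop (.sub (.add (.var 0) (.const 4)) (.var 3))
      (.seq (t.compile 20) (.seq (.store a (.var 2) (.var 3) (.var 20))
        (.assign 3 (.add (.var 3) (.const 1))))))
      (.assign 2 (.add (.var 2) (.const 1))))))

/-- A polynomial bound for the running time of `fill`. -/
noncomputable def fillTime (t : Term) : Polynomial ℕ :=
  2 + ((.X + 4) * (6 + (2 + (((.X + 4) * (6 + (t.time + (4 + 4))) + 6) + 4))) + 6)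

/-- The effect of `fill a t`. -/
structure Filled (a : ℕ) (t : Term) (s s' : State) : Prop where
  var : ∀ x < 20, x ≠ 2 → x ≠ 3 → s'.var x = s.var x
  arr_of_ne : ∀ b ≠ a, s'.arr b = s.arr b
  arr : ∀ i < s.var 0 + 4, ∀ j < s.var 0 + 4,
    s'.arr a i j = t.eval ((s.setVar 2 i).setVar 3 j)

/-- Since t does not read array a, entries already stored do not affect those still to be computed.
Scratch memory starts at variable 20, above the loop indices and all variables of t. -/
theorem runs_fill {a : ℕ} {t : Term} (ht : t.Below 20) (ha : t.Avoids a) (s : State) :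
    Runs (fill a t) ((fillTime t).eval (s.var 0)) s (Filled a t s) := by
  set n := s.var 0 with hn
  have hB : (fillTime t).eval n = 2 + ((n + 4) * (6 + (2 + (((n + 4) *
      (6 + (t.time.eval n + (4 + 4))) + 6) + 4))) + 6) := by simp [fillTime]
  rw [hB]
  refine (runs_assign _ _ s).seq ?_
  rintro _ rfl
  refine (runs_loop (e := .sub (.add (.var 0) (.const 4)) (.var 2)) (N := n + 4)
    (Inv := fun i s' => s'.var 2 = i ∧
    (∀ x < 20, x ≠ 2 → x ≠ 3 → s'.var x = s.var x) ∧ (∀ b ≠ a, s'.arr b = s.arr b) ∧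
    ∀ i' < i, ∀ j < n + 4, s'.arr a i' j = t.eval ((s.setVar 2 i').setVar 3 j)) ?_ ?_ ?_).mono
    le_rfl ?_
  · rintro i s' ⟨h1, h2, -⟩
    simp [Expr.eval, h1, h2 0, hn]
  · rintro i hi s₁ ⟨h1, h2, h3, h4⟩
    refine (runs_assign _ _ s₁).seq ?_
    rintro _ rfl
    refine (runs_loop (e := .sub (.add (.var 0) (.const 4)) (.var 3)) (N := n + 4)
      (Inv := fun j s' => s'.var 3 = j ∧ s'.var 2 = i ∧
      (∀ x < 20, x ≠ 2 → x ≠ 3 → s'.var x = s.var x) ∧ (∀ b ≠ a, s'.arr b = s.arr b) ∧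
      (∀ i' < i, ∀ j < n + 4, s'.arr a i' j = t.eval ((s.setVar 2 i').setVar 3 j)) ∧
      ∀ j' < j, s'.arr a i j' = t.eval ((s.setVar 2 i).setVar 3 j')) ?_ ?_ ?_).seq ?_
    · rintro j s' ⟨h1, h2, h3, -⟩
      simp [Expr.eval, h1, h3 0, hn]
    · rintro j hj s₂ ⟨k1, k2, k3, k4, k5, k6⟩
      have hrun := t.runs_compile ht (by norm_num) s₂
      rw [k3 0 (by norm_num) (by norm_num) (by norm_num), ← hn] at hrun
      refine hrun.seq fun s₃ ⟨l1, l2, l3⟩ => ?_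
      refine (runs_store _ _ _ _ _).seq ?_
      rintro _ rfl
      refine (runs_assign _ _ _).mono le_rfl ?_
      rintro _ rfl
      have hv : t.eval s₂ = t.eval ((s.setVar 2 i).setVar 3 j) := by
        refine t.eval_congr (a := a) ht (by norm_num) (fun x hx => ?_) (Or.inl ha) k4
        by_cases h3 : x = 3
        · subst h3; simp [k1]
        by_cases h2 : x = 2
        · subst h2; simp [State.setVar_var_of_ne, k2]
        · simp [State.setVar_var_of_ne, h2, h3, k3 x hx]
      have e1 : s₃.var 2 = i := (l2 2 (by norm_num)).trans k2
      have e2 : s₃.var 3 = j := (l2 3 (by norm_num)).trans k1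
      refine ⟨?_, ?_, fun x hx hx2 hx3 => ?_, fun b hb => ?_, fun i' hi' j' hj' => ?_,
        fun j' hj' => ?_⟩
      · simp [Expr.eval, e2]
      · simp [State.setVar_var_of_ne, e1]
      · simp [State.setVar_var_of_ne, hx3, l2 x hx, k3 x hx hx2 hx3]
      · funext i' j'
        simp [State.setArr, hb, l3, k4]
      · simp [State.setArr, Expr.eval, e1, hi'.ne, l3, k5 i' hi' j' hj']
      · simp only [State.setVar_arr, State.setArr, Expr.eval, e1, e2, true_and, l3, l1, hv]
        by_cases h : j' = j
        · simp [h]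
        · simp [h, k6 j' (by omega)]
    · refine ⟨?_, ?_, fun x hx hx2 hx3 => ?_, h3, h4, by simp⟩
      · simp [Expr.eval]
      · simp [State.setVar_var_of_ne, h1]
      · simp [State.setVar_var_of_ne, hx3, h2 x hx hx2 hx3]
    · rintro s₂ ⟨k1, k2, k3, k4, k5, k6⟩
      refine (runs_assign _ _ _).mono le_rfl ?_
      rintro _ rfl
      refine ⟨?_, fun x hx hx2 hx3 => ?_, k4, fun i' hi' j' hj' => ?_⟩
      · simp [Expr.eval, k2]
      · simp [State.setVar_var_of_ne, hx2, k3 x hx hx2 hx3]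
      · rcases Nat.lt_succ_iff_lt_or_eq.1 hi' with h | rfl
        · exact k5 i' h j' hj'
        · exact k6 j' hj'
  · refine ⟨by simp [Expr.eval], fun x hx hx2 hx3 => ?_, fun b _ => rfl, by simp⟩
    simp [State.setVar_var_of_ne, hx2]
  · rintro s' ⟨-, h2, h3, h4⟩
    exact ⟨h2, h3, h4⟩

/-- A program that executes `p` as often as the value of variable `0` says. -/
def iter (p : Prog) : Prog :=
  .seq (.assign 4 (.const 0)) (.loop (.sub (.var 0) (.var 4))
    (.seq p (.assign 4 (.add (.var 4) (.const 1)))))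

/-- Variable 4 counts the rounds, so the invariant must be insensitive to it and p must preserve it.
-/
theorem runs_iter {p : Prog} {n B : ℕ} {Inv : ℕ → State → Prop}
    (h0 : ∀ i s, Inv i s → s.var 0 = n) (h4 : ∀ i s v, Inv i s → Inv i (s.setVar 4 v))
    (hp : ∀ i < n, ∀ s, Inv i s → Runs p B s fun s' => Inv (i + 1) s' ∧ s'.var 4 = s.var 4)
    {s : State} (hs : Inv 0 s) :
    Runs (iter p) (2 + (n * (4 + (B + 4)) + 4)) s (Inv n) := by
  refine (runs_assign _ _ s).seq ?_
  rintro _ rfl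
  refine (runs_loop (e := .sub (.var 0) (.var 4)) (N := n)
    (Inv := fun i s' => Inv i s' ∧ s'.var 4 = i) ?_ ?_ ?_).mono le_rfl fun _ h => h.1
  · rintro i s' ⟨h1, h2⟩
    simp [Expr.eval, h0 i s' h1, h2]
  · rintro i hi s₁ ⟨h1, h2⟩
    refine (hp i hi s₁ h1).seq fun s₂ ⟨k1, k2⟩ => ?_
    refine (runs_assign _ _ _).mono le_rfl ?_
    rintro _ rfl
    exact ⟨h4 _ _ _ k1, by simp [Expr.eval, k2, h2]⟩
  · exact ⟨h4 _ _ _ hs, by simp [Expr.eval]⟩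

/-! ## Formulas -/

namespace Term

/-- Negation. -/
def not (t : Term) : Term := .sub (.const 1) t

/-- Conjunction. -/
def and (t u : Term) : Term := not (.add (not t) (not u))

/-- Disjunction. -/
def or (t u : Term) : Term := not (not (.add t u))

/-- The comparison `t ≤ u`. -/
def le (t u : Term) : Term := not (.sub t u)

/-- The comparison `t < u`. -/
def lt (t u : Term) : Term := not (.sub (.add t (.const 1)) u)

/-- Equality. -/
def eq (t u : Term) : Term := not (.add (.sub t u) (.sub u t))

/-- Existential quantification. -/
def ex (x : ℕ) (t : Term) : Term := not (not (.sum x t))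

open scoped Classical

/-- The truth value of a proposition. -/
noncomputable def ind (p : Prop) : ℕ := if p then 1 else 0

theorem ind_eq_zero {p : Prop} : ind p = 0 ↔ ¬ p := by
  unfold ind; split_ifs <;> simp_all

theorem ind_ne_zero {p : Prop} : ind p ≠ 0 ↔ p := by
  rw [ne_eq, ind_eq_zero, not_not]

variable {t u : Term} {s : State} {p q : Prop}

theorem eval_const (c : ℕ) : (const c).eval s = c := rfl

theorem eval_var (x : ℕ) : (var x).eval s = s.var x := rfl

theorem eval_get (a : ℕ) : (get a t u).eval s = s.arr a (t.eval s) (u.eval s) := rfl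

theorem eval_add : (add t u).eval s = t.eval s + u.eval s := rfl

theorem eval_sub : (sub t u).eval s = t.eval s - u.eval s := rfl

theorem eval_ite {c : Term} {a b : ℕ} {_ : Decidable p} (hc : c.eval s = ind p) (h : t.eval s = a)
    (h' : u.eval s = b) : (ite c t u).eval s = if p then a else b := by
  simp only [eval, hc, h, h', ind_ne_zero]

theorem eval_not (h : t.eval s = ind p) : t.not.eval s = ind (¬ p) := by
  rw [not, eval_sub, h]
  by_cases p <;> simp_all [ind, eval_const]

theorem eval_or (h : t.eval s = ind p) (h' : u.eval s = ind q) :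
    (t.or u).eval s = ind (p ∨ q) := by
  simp only [or, not, eval_sub, eval_add, eval_const, h, h']
  by_cases p <;> by_cases q <;> simp_all [ind]

theorem eval_and (h : t.eval s = ind p) (h' : u.eval s = ind q) :
    (t.and u).eval s = ind (p ∧ q) := by
  simp only [and, not, eval_sub, eval_add, eval_const, h, h']
  by_cases p <;> by_cases q <;> simp_all [ind]

theorem eval_le {a b : ℕ} (h : t.eval s = a) (h' : u.eval s = b) :
    (t.le u).eval s = ind (a ≤ b) := by
  simp only [le, not, eval_sub, eval_const, h, h', ind]
  split_ifs <;> omega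

theorem eval_lt {a b : ℕ} (h : t.eval s = a) (h' : u.eval s = b) :
    (t.lt u).eval s = ind (a < b) := by
  simp only [lt, not, eval_sub, eval_add, eval_const, h, h', ind]
  split_ifs <;> omega

theorem eval_eq {a b : ℕ} (h : t.eval s = a) (h' : u.eval s = b) :
    (t.eq u).eval s = ind (a = b) := by
  simp only [eq, not, eval_sub, eval_add, eval_const, h, h', ind]
  split_ifs <;> omega

theorem eval_sum {n x : ℕ} (hn : s.var 0 = n) {f : Fin n → ℕ}
    (h : ∀ i : Fin n, t.eval (s.setVar x i) = f i) : (sum x t).eval s = ∑ i, f i := by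
  subst hn
  rw [eval, sum_range]
  exact sum_congr rfl fun i _ => h i

/-- A sum of truth values is nonzero exactly if one of them is, and double truncated negation turns
any nonzero value into 1. -/
theorem eval_ex {n x : ℕ} (hn : s.var 0 = n) {P : Fin n → Prop}
    (h : ∀ i : Fin n, t.eval (s.setVar x i) = ind (P i)) :
    (ex x t).eval s = ind (∃ i, P i) := by
  have h' : ∑ i, ind (P i) = 0 ↔ ¬ ∃ i, P i := by
    simp [sum_eq_zero_iff, ind_eq_zero]
  simp only [ex, not, eval_sub, eval_const, eval_sum hn h]
  by_cases hP : ∃ i, P i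
  · have : ∑ i, ind (P i) ≠ 0 := fun h => h'.1 h hP
    simp only [ind, hP, if_true] at *
    omega
  · rw [h'.2 hP]
    simp [ind, hP]

end Term

section Algorithm

open scoped Classical
open Term

/-! ## The algorithm -/

/-- One step in the computation of the reachability relation, in array `1`. -/
def reachStep : Term :=
  .or (.get 1 (.var 2) (.var 3)) (.ex 5 (.and (.get 0 (.var 2) (.var 5)) (.get 1 (.var 5) (.var 3))))

/-- A program that stores the reachability relation in array `1`. -/
def reachProg : Prog :=
  .seq (fill 1 (.eq (.var 2) (.var 3)))
    -- Array 2 buffers each round, because `fill` must not read the array that it writes.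
    (iter (.seq (fill 2 reachStep) (fill 1 (.get 2 (.var 2) (.var 3)))))

/-- The term for `obstruction`, to be stored in array `3`. -/
def obstructionTerm : Term :=
  .and (.not (.eq (.var 2) (.var 3))) (.and (.not (.get 0 (.var 2) (.var 3)))
    (.and (.get 1 (.var 2) (.var 3)) (.ex 5 (.ex 6 (.ex 7 (.and (.get 1 (.var 2) (.var 5))
      (.and (.get 0 (.var 5) (.var 6)) (.and (.get 0 (.var 6) (.var 7))
        (.get 0 (.var 5) (.var 7))))))))))

/-- The term for `closedNbhd`, to be stored in array `4`. -/
def closedNbhdTerm : Term := .or (.eq (.var 2) (.var 3)) (.get 3 (.var 2) (.var 3))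

/-- The term for the cut of the closed neighborhood of a vertex. -/
def cutTerm : Term :=
  .sum 5 (.sum 6 (.and (.get 4 (.var 2) (.var 5)) (.and (.not (.get 4 (.var 2) (.var 6)))
    (.get 3 (.var 5) (.var 6)))))

/-- The term for `Good`, to be stored in array `5`. -/
def goodTerm : Term :=
  .and (.not (.ex 5 (.ex 6 (.and (.get 4 (.var 2) (.var 5)) (.and (.get 4 (.var 2) (.var 6))
      (.not (.get 4 (.var 5) (.var 6))))))))
    (.or (.eq cutTerm (.const 0))
      (.le (.add cutTerm (.const 2)) (.sum 5 (.get 4 (.var 2) (.var 5)))))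

/-- The term for `Same`, to be stored in array `6`. -/
def sameTerm : Term :=
  .ex 5 (.and (.get 5 (.var 5) (.var 5)) (.and (.get 4 (.var 5) (.var 2)) (.get 4 (.var 5) (.var 3))))

/-- The term for `cost`, to be stored in array `7`. -/
def costTerm : Term :=
  .sum 5 (.sum 6 (.and (.and (.get 3 (.var 5) (.var 6)) (.and (.or (.get 6 (.var 5) (.var 5))
    (.get 6 (.var 6) (.var 6))) (.not (.get 6 (.var 5) (.var 6))))) (.lt (.var 5) (.var 6))))

/-- The term for `rank`, to be stored in array `8`. -/
def rankTerm : Term :=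
  .sum 5 (.and (.lt (.var 5) (.var 2)) (.not (.get 6 (.var 5) (.var 5))))

/-- The term for `order`, to be stored in array `9`. -/
def orderTerm : Term := .sum 5 (.not (.get 6 (.var 5) (.var 5)))

/-- The entry `(0, 0)` of array `a`. -/
def scalar (a : ℕ) : Term := .get a (.const 0) (.const 0)

/-- The term for `Reject`, to be stored in array `10`. -/
def rejectTerm : Term :=
  .or (.lt (.var 1) (scalar 7))
    (.lt (.add (.add (.var 1) (.var 1)) (.add (.var 1) (.var 1))) (scalar 9))

/-- The term for the parameter of the kernel, to be stored in array `11`. -/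
def parameterTerm : Term := .ite (scalar 10) (.const 0) (.sub (.var 1) (scalar 7))

/-- The term for the number of vertices of the kernel, to be stored in array `12`. -/
def vertexTerm : Term :=
  .ite (scalar 10) (.const 4) (.ite (.eq (scalar 9) (.const 0)) (.const 0) (.add (scalar 9) (.const 1)))

/-- The term for the graph of the kernel, to be stored in array `0`. -/
def graphTerm : Term :=
  .and (.not (.eq (.var 2) (.var 3))) (.ite (scalar 10)
    (.or (.eq (.var 2) (.const 0)) (.or (.eq (.var 3) (.const 0))
      (.and (.le (.var 2) (.const 2)) (.le (.var 3) (.const 2)))))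
    (.not (.ex 5 (.ex 6 (.and (.not (.get 6 (.var 5) (.var 5))) (.and (.not (.get 6 (.var 6) (.var 6)))
      (.and (.eq (.get 8 (.var 5) (.var 5)) (.var 2)) (.and (.eq (.get 8 (.var 6) (.var 6)) (.var 3))
        (.get 3 (.var 5) (.var 6))))))))))

/-- The kernelization algorithm. -/
def kernelProg : Prog :=
  .seq reachProg (.seq (fill 3 obstructionTerm) (.seq (fill 4 closedNbhdTerm) (.seq (fill 5 goodTerm)
    (.seq (fill 6 sameTerm) (.seq (fill 7 costTerm) (.seq (fill 8 rankTerm) (.seq (fill 9 orderTerm)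
      (.seq (fill 10 rejectTerm) (.seq (fill 11 parameterTerm) (.seq (fill 12 vertexTerm)
        -- The input matrix, k and n are overwritten only now, since earlier terms depend on them.
        (.seq (fill 0 graphTerm) (.seq (.assign 1 (.get 11 (.const 0) (.const 0)))
          (.assign 0 (.get 12 (.const 0) (.const 0)))))))))))))))

/-- A polynomial bound for the running time of `reachProg`. -/
noncomputable def reachTime : Polynomial ℕ :=
  fillTime (.eq (.var 2) (.var 3)) + (2 + (.X * (4 + ((fillTime reachStep +
    fillTime (.get 2 (.var 2) (.var 3))) + 4)) + 4))

/-- A polynomial bound for the running time of the algorithm. -/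
noncomputable def kernelTime : Polynomial ℕ :=
  reachTime + (fillTime obstructionTerm + (fillTime closedNbhdTerm + (fillTime goodTerm +
    (fillTime sameTerm + (fillTime costTerm + (fillTime rankTerm + (fillTime orderTerm +
      (fillTime rejectTerm + (fillTime parameterTerm + (fillTime vertexTerm +
        (fillTime graphTerm + (4 + 4))))))))))))

/-- What the array `a` contains when it has been computed from the instance `I`. -/
def Content (I : Instance) : ℕ → (ℕ → ℕ → ℕ) → Prop
  | 0, M => ∀ i j : Fin I.n, M i j = ind (I.G.Adj i j)
  | 1, M => ∀ i j : Fin I.n, M i j = ind (I.G.Reachable i j)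
  | 2, _ => True
  | 3, M => ∀ i j : Fin I.n, M i j = ind ((obstruction I.G).Adj i j)
  | 4, M => ∀ i j : Fin I.n, M i j = ind (j ∈ closedNbhd (obstruction I.G) i)
  | 5, M => ∀ i j : Fin I.n, M i j = ind (Good (obstruction I.G) i)
  | 6, M => ∀ i j : Fin I.n, M i j = ind (Same (obstruction I.G) i j)
  | 7, M => M 0 0 = cost (obstruction I.G)
  | 8, M => ∀ i j : Fin I.n, M i j = rank (obstruction I.G) i
  | 9, M => M 0 0 = order (obstruction I.G)
  | 10, M => M 0 0 = ind (Reject I)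
  | 11, M => M 0 0 = (kernel I).k
  | 12, M => M 0 0 = (kernel I).n
  | _, _ => True

/-- The configurations in which the arrays below `m` have been computed. -/
structure Stage (I : Instance) (m : ℕ) (s : State) : Prop where
  var_zero : s.var 0 = I.n
  var_one : s.var 1 = I.k
  arr : ∀ a < m, Content I a (s.arr a)

theorem Filled.arr_fin {I : Instance} {a m : ℕ} {t : Term} {s s' : State} (h : Filled a t s s')
    (hs : Stage I m s) (i j : Fin I.n) : s'.arr a i j = t.eval ((s.setVar 2 i).setVar 3 j) :=
  h.arr i (by rw [hs.var_zero]; omega) j (by rw [hs.var_zero]; omega)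

theorem Filled.arr_zero {a : ℕ} {t : Term} {s s' : State} (h : Filled a t s s') :
    s'.arr a 0 0 = t.eval ((s.setVar 2 0).setVar 3 0) :=
  h.arr 0 (by omega) 0 (by omega)

theorem Stage.runs_fill {I : Instance} {m : ℕ} {t : Term} {s : State} (hs : Stage I m s)
    (ht : t.Below 20) (ha : t.Avoids m)
    (h : ∀ s', Filled m t s s' → Content I m (s'.arr m)) :
    Runs (fill m t) ((fillTime t).eval I.n) s (Stage I (m + 1)) := by
  have := PawCompletion.runs_fill ht ha s
  rw [hs.var_zero] at this
  refine this.mono le_rfl fun s' hs' => ⟨?_, ?_, fun a ha => ?_⟩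
  · rw [hs'.var 0 (by norm_num) (by norm_num) (by norm_num), hs.var_zero]
  · rw [hs'.var 1 (by norm_num) (by norm_num) (by norm_num), hs.var_one]
  · rcases Nat.lt_succ_iff_lt_or_eq.1 ha with ha | rfl
    · rw [hs'.arr_of_ne a ha.ne]
      exact hs.arr a ha
    · exact h s' hs'

theorem adjEntry_eq {n : ℕ} (G : SimpleGraph (Fin n)) (i j : Fin n) :
    adjEntry G i j = ind (G.Adj i j) := by
  have : (∃ u v : Fin n, (u : ℕ) = i ∧ (v : ℕ) = j ∧ G.Adj u v) ↔ G.Adj i j :=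
    ⟨fun ⟨u, v, hu, hv, h⟩ => Fin.ext hu ▸ Fin.ext hv ▸ h, fun h => ⟨i, j, rfl, rfl, h⟩⟩
  simp only [adjEntry, ind, this]

theorem stage_init (I : Instance) : Stage I 1 I.init := by
  refine ⟨rfl, rfl, fun a ha => ?_⟩
  obtain rfl : a = 0 := by omega
  exact adjEntry_eq I.G

theorem exists_walk_succ_iff {V : Type*} {G : SimpleGraph V} {u v : V} {m : ℕ} :
    (∃ p : G.Walk u v, p.length ≤ m + 1) ↔
      (∃ p : G.Walk u v, p.length ≤ m) ∨ ∃ x, G.Adj u x ∧ ∃ p : G.Walk x v, p.length ≤ m := by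
  constructor
  · rintro ⟨p, hp⟩
    cases p with
    | nil => exact Or.inl ⟨.nil, Nat.zero_le _⟩
    | cons h p => exact Or.inr ⟨_, h, p, by simpa using hp⟩
  · rintro (⟨p, hp⟩ | ⟨x, h, p, hp⟩)
    · exact ⟨p, hp.trans (Nat.le_succ m)⟩
    · exact ⟨.cons h p, by simpa using hp⟩

theorem exists_walk_zero_iff {V : Type*} {G : SimpleGraph V} {u v : V} :
    (∃ p : G.Walk u v, p.length ≤ 0) ↔ u = v := by
  constructor
  · rintro ⟨p, hp⟩
    exact p.eq_of_length_eq_zero (Nat.le_zero.1 hp)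
  · rintro rfl
    exact ⟨.nil, le_rfl⟩

/-- A walk can be shortened to a path, which has fewer than n edges; hence n rounds suffice. -/
theorem exists_walk_iff_reachable {n : ℕ} {G : SimpleGraph (Fin n)} {u v : Fin n} :
    (∃ p : G.Walk u v, p.length ≤ n) ↔ G.Reachable u v := by
  refine ⟨fun ⟨p, _⟩ => ⟨p⟩, fun ⟨p⟩ => ⟨p.toPath, ?_⟩⟩
  have := p.toPath.2.length_lt
  rw [Fintype.card_fin] at this
  exact this.le

/-- The configurations after `m` steps of the computation of the reachability relation. -/
structure ReachStage (I : Instance) (m : ℕ) (s : State) : Prop where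
  stage : Stage I 1 s
  arr : ∀ i j : Fin I.n, s.arr 1 i j = ind (∃ p : I.G.Walk i j, p.length ≤ m)

theorem runs_reachProg {I : Instance} {s : State} (hs : Stage I 1 s) :
    Runs reachProg (reachTime.eval I.n) s (Stage I 2) := by
  have keep : ∀ {a t s s'}, a ≠ 0 → Stage I 1 s → Filled a t s s' → Stage I 1 s' := by
    intro a t s s' h0 hs h
    refine ⟨?_, ?_, fun a ha => ?_⟩
    · rw [h.var 0 (by norm_num) (by norm_num) (by norm_num), hs.var_zero]
    · rw [h.var 1 (by norm_num) (by norm_num) (by norm_num), hs.var_one]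
    · obtain rfl : a = 0 := by omega
      rw [h.arr_of_ne 0 h0.symm]
      exact hs.arr 0 ha
  have hB : reachTime.eval I.n = (fillTime (.eq (.var 2) (.var 3))).eval I.n + (2 + (I.n *
      (4 + (((fillTime reachStep).eval I.n + (fillTime (.get 2 (.var 2) (.var 3))).eval I.n) + 4)) +
        4)) := by
    simp [reachTime]
  have fill' : ∀ {a t s}, t.Below 20 → t.Avoids a → Stage I 1 s →
      Runs (fill a t) ((fillTime t).eval I.n) s (Filled a t s) := by
    intro a t s ht ha hs
    have := PawCompletion.runs_fill ht ha s
    rwa [hs.var_zero] at this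
  rw [hB]
  refine ((fill' (by simp [Below, Term.eq, Term.not]) (by simp [Avoids, Term.eq, Term.not]) hs).mono
    le_rfl (Q' := ReachStage I 0) fun s' h => ?_).seq fun s₁ h₁ => (runs_iter
    (Inv := ReachStage I) ?_ ?_ ?_ h₁).mono le_rfl fun s₂ h₂ => ?_
  · refine ⟨keep (by norm_num) hs h, fun i j => ?_⟩
    rw [h.arr_fin hs, eval_eq rfl rfl, exists_walk_zero_iff]
    simp [eval_var, State.setVar, Fin.ext_iff]
  · exact fun i s h => h.stage.var_zero
  · rintro i s v ⟨⟨h1, h2, h3⟩, h4⟩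
    exact ⟨⟨h1, h2, h3⟩, h4⟩
  · rintro i hi s h
    refine (fill' (by simp [reachStep, Below, Term.or, Term.and, Term.ex, Term.not])
      (by simp [reachStep, Avoids, Term.or, Term.and, Term.ex, Term.not]) h.stage).seq
      fun s₁ h₁ => ?_
    have hs₁ := keep (by norm_num) h.stage h₁
    refine (fill' (by simp [Below]) (by simp [Avoids]) hs₁).mono le_rfl fun s₂ h₂ =>
      ⟨⟨keep (by norm_num) hs₁ h₂, fun i j => ?_⟩, ?_⟩
    · rw [h₂.arr_fin hs₁]
      have h0 : ∀ i j : Fin I.n, s.arr 0 i j = ind (I.G.Adj i j) := h.stage.arr 0 (by norm_num)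
      have : s₁.arr 2 i j = _ := h₁.arr_fin h.stage i j
      have e : (Term.get 2 (.var 2) (.var 3)).eval ((s₁.setVar 2 i).setVar 3 j) = s₁.arr 2 i j := by
        simp [eval_get, eval_var, State.setVar]
      rw [e, this, exists_walk_succ_iff]
      refine eval_or ?_ (eval_ex ?_ fun x => eval_and ?_ ?_)
      · simp [eval_get, eval_var, State.setVar, h.arr]
      · simp [State.setVar, h.stage.var_zero]
      · simp [eval_get, eval_var, State.setVar, h0]
      · simp [eval_get, eval_var, State.setVar, h.arr]
    · rw [h₂.var 4 (by norm_num) (by norm_num) (by norm_num),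
        h₁.var 4 (by norm_num) (by norm_num) (by norm_num)]
  · refine ⟨h₂.stage.var_zero, h₂.stage.var_one, fun a ha => ?_⟩
    by_cases h0 : a = 0
    · exact h₂.stage.arr a (by omega)
    · obtain rfl : a = 1 := by omega
      intro i j
      rw [h₂.arr, exists_walk_iff_reachable]

end Algorithm

/-! ### Correctness of the algorithm, array by array -/

section Stages

open scoped Classical
open Term

theorem card_eq_sum_ind {α : Type*} [Fintype α] (P : α → Prop) {_ : DecidablePred P} :
    #{x | P x} = ∑ x, ind (P x) := by
  rw [card_filter]
  simp only [ind]
  congr!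

theorem card_eq_sum_sum_ind {α : Type*} [Fintype α] (P : α → α → Prop)
    {_ : DecidablePred fun p : α × α => P p.1 p.2} :
    #{p : α × α | P p.1 p.2} = ∑ x, ∑ y, ind (P x y) := by
  rw [card_eq_sum_ind, ← univ_product_univ, sum_product]

/-- This form can be evaluated from the array of closed neighborhoods: adjacency or equality becomes
membership, and the cardinality becomes a sum of truth values. -/
theorem good_iff {V : Type*} [Fintype V] {H : SimpleGraph V} {v : V} :
    Good H v ↔ (¬ ∃ x y, x ∈ closedNbhd H v ∧ y ∈ closedNbhd H v ∧ ¬ y ∈ closedNbhd H x) ∧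
      (cut H (closedNbhd H v) = 0 ∨
        cut H (closedNbhd H v) + 2 ≤ ∑ x, ind (x ∈ closedNbhd H v)) := by
  rw [Good, ← card_eq_sum_ind, filter_univ_mem]
  refine and_congr_left fun _ => ?_
  push Not
  simp only [mem_closedNbhd]
  exact ⟨fun h x y hx hy => h x hx y hy, fun h x hx y hy => h x y hx hy⟩

variable {I : Instance} {s : State}

theorem Stage.runs_obstructionTerm (hs : Stage I 3 s) :
    Runs (fill 3 obstructionTerm) ((fillTime obstructionTerm).eval I.n) s (Stage I 4) := by
  refine hs.runs_fill
    (by simp [obstructionTerm, Below, Term.eq, Term.and, Term.ex, Term.not])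
    (by simp [obstructionTerm, Avoids, Term.eq, Term.and, Term.ex, Term.not])
    fun s' h i j => ?_
  have h0 : ∀ i j : Fin I.n, s.arr 0 i j = ind (I.G.Adj i j) := hs.arr 0 (by norm_num)
  have h1 : ∀ i j : Fin I.n, s.arr 1 i j = ind (I.G.Reachable i j) := hs.arr 1 (by norm_num)
  rw [h.arr_fin hs, obstruction_adj, ne_eq, Fin.ext_iff]
  refine eval_and (eval_not (eval_eq ?_ ?_)) (eval_and (eval_not ?_) (eval_and ?_ (eval_ex ?_ fun x =>
    eval_ex ?_ fun y => eval_ex ?_ fun z => eval_and ?_ (eval_and ?_ (eval_and ?_ ?_)))))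
  all_goals simp [eval_get, eval_var, State.setVar, hs.var_zero, h0, h1]

theorem Stage.runs_closedNbhdTerm (hs : Stage I 4 s) :
    Runs (fill 4 closedNbhdTerm) ((fillTime closedNbhdTerm).eval I.n) s (Stage I 5) := by
  refine hs.runs_fill
    (by simp [closedNbhdTerm, Below, Term.eq, Term.or, Term.not])
    (by simp [closedNbhdTerm, Avoids, Term.eq, Term.or, Term.not]) fun s' h i j => ?_
  have h3 : ∀ i j : Fin I.n, s.arr 3 i j = ind ((obstruction I.G).Adj i j) :=
    hs.arr 3 (by norm_num)
  rw [h.arr_fin hs, mem_closedNbhd, Fin.ext_iff]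
  refine eval_or (eval_eq ?_ ?_) ?_
  all_goals simp [eval_get, eval_var, State.setVar, h3]

theorem Stage.runs_goodTerm (hs : Stage I 5 s) :
    Runs (fill 5 goodTerm) ((fillTime goodTerm).eval I.n) s (Stage I 6) := by
  refine hs.runs_fill
    (by simp [goodTerm, cutTerm, Below, Term.eq, Term.le, Term.or, Term.and, Term.ex, Term.not])
    (by simp [goodTerm, cutTerm, Avoids, Term.eq, Term.le, Term.or, Term.and, Term.ex, Term.not])
    fun s' h i j => ?_
  have h3 : ∀ i j : Fin I.n, s.arr 3 i j = ind ((obstruction I.G).Adj i j) :=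
    hs.arr 3 (by norm_num)
  have h4 : ∀ i j : Fin I.n, s.arr 4 i j = ind (j ∈ closedNbhd (obstruction I.G) i) :=
    hs.arr 4 (by norm_num)
  have hcut : cutTerm.eval ((s.setVar 2 i).setVar 3 j) =
      cut (obstruction I.G) (closedNbhd (obstruction I.G) i) := by
    rw [cut, card_eq_sum_sum_ind (fun x y => x ∈ closedNbhd (obstruction I.G) i ∧
      y ∉ closedNbhd (obstruction I.G) i ∧ (obstruction I.G).Adj x y)]
    refine eval_sum ?_ fun x => eval_sum ?_ fun y => eval_and ?_ (eval_and (eval_not ?_) ?_)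
    all_goals simp [eval_get, eval_var, State.setVar, hs.var_zero, h3, h4]
  rw [h.arr_fin hs, good_iff]
  refine eval_and (eval_not (eval_ex ?_ fun x => eval_ex ?_ fun y => eval_and ?_
    (eval_and ?_ (eval_not ?_)))) (eval_or (eval_eq hcut (eval_const 0))
      (eval_le ?_ (eval_sum ?_ fun x => ?_)))
  case refine_6 => rw [eval_add, hcut, eval_const]
  all_goals simp [eval_get, eval_var, State.setVar, hs.var_zero, h4]

theorem Stage.runs_sameTerm (hs : Stage I 6 s) :
    Runs (fill 6 sameTerm) ((fillTime sameTerm).eval I.n) s (Stage I 7) := by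
  refine hs.runs_fill (by simp [sameTerm, Below, Term.and, Term.ex, Term.not])
    (by simp [sameTerm, Avoids, Term.and, Term.ex, Term.not]) fun s' h i j => ?_
  have h4 : ∀ i j : Fin I.n, s.arr 4 i j = ind (j ∈ closedNbhd (obstruction I.G) i) :=
    hs.arr 4 (by norm_num)
  have h5 : ∀ i j : Fin I.n, s.arr 5 i j = ind (Good (obstruction I.G) i) := hs.arr 5 (by norm_num)
  rw [h.arr_fin hs]
  refine eval_ex ?_ fun v => eval_and ?_ (eval_and ?_ ?_)
  all_goals simp [eval_get, eval_var, State.setVar, hs.var_zero, h4, h5]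

theorem Stage.runs_costTerm (hs : Stage I 7 s) :
    Runs (fill 7 costTerm) ((fillTime costTerm).eval I.n) s (Stage I 8) := by
  refine hs.runs_fill (by simp [costTerm, Below, Term.lt, Term.or, Term.and, Term.not])
    (by simp [costTerm, Avoids, Term.lt, Term.or, Term.and, Term.not]) fun s' h => ?_
  have h3 : ∀ i j : Fin I.n, s.arr 3 i j = ind ((obstruction I.G).Adj i j) :=
    hs.arr 3 (by norm_num)
  have h6 : ∀ i j : Fin I.n, s.arr 6 i j = ind (Same (obstruction I.G) i j) :=
    hs.arr 6 (by norm_num)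
  change _ = cost _
  rw [h.arr_zero, cost, lost, filter_filter, card_eq_sum_sum_ind fun x y : Fin I.n =>
    ((obstruction I.G).Adj x y ∧ (Same (obstruction I.G) x x ∨ Same (obstruction I.G) y y) ∧
      ¬ Same (obstruction I.G) x y) ∧ x < y]
  refine eval_sum ?_ fun x => eval_sum ?_ fun y => eval_and (eval_and ?_ (eval_and (eval_or ?_ ?_)
    (eval_not ?_))) (eval_lt ?_ ?_)
  all_goals simp [eval_get, eval_var, State.setVar, hs.var_zero, h3, h6]

theorem Stage.runs_rankTerm (hs : Stage I 8 s) :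
    Runs (fill 8 rankTerm) ((fillTime rankTerm).eval I.n) s (Stage I 9) := by
  refine hs.runs_fill (by simp [rankTerm, Below, Term.lt, Term.and, Term.not])
    (by simp [rankTerm, Avoids, Term.lt, Term.and, Term.not]) fun s' h i j => ?_
  have h6 : ∀ i j : Fin I.n, s.arr 6 i j = ind (Same (obstruction I.G) i j) :=
    hs.arr 6 (by norm_num)
  rw [h.arr_fin hs, rank, card_eq_sum_ind]
  refine eval_sum ?_ fun x => eval_and (eval_lt ?_ ?_) (eval_not ?_)
  all_goals simp [eval_get, eval_var, State.setVar, hs.var_zero, h6]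

theorem Stage.runs_orderTerm (hs : Stage I 9 s) :
    Runs (fill 9 orderTerm) ((fillTime orderTerm).eval I.n) s (Stage I 10) := by
  refine hs.runs_fill (by simp [orderTerm, Below, Term.not])
    (by simp [orderTerm, Avoids, Term.not]) fun s' h => ?_
  have h6 : ∀ i j : Fin I.n, s.arr 6 i j = ind (Same (obstruction I.G) i j) :=
    hs.arr 6 (by norm_num)
  change _ = order _
  rw [h.arr_zero, order, card_eq_sum_ind]
  refine eval_sum ?_ fun x => eval_not ?_
  all_goals simp [eval_get, eval_var, State.setVar, hs.var_zero, h6]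

theorem eval_scalar {a c : ℕ} (h : s.arr a 0 0 = c) (i j : ℕ) :
    (scalar a).eval ((s.setVar 2 i).setVar 3 j) = c := h

theorem Stage.runs_rejectTerm (hs : Stage I 10 s) :
    Runs (fill 10 rejectTerm) ((fillTime rejectTerm).eval I.n) s (Stage I 11) := by
  refine hs.runs_fill (by simp [rejectTerm, scalar, Below, Term.lt, Term.or, Term.not])
    (by simp [rejectTerm, scalar, Avoids, Term.lt, Term.or, Term.not]) fun s' h => ?_
  change _ = ind (Reject I)
  rw [h.arr_zero]
  refine eval_or (eval_lt hs.var_one (eval_scalar (hs.arr 7 (by norm_num)) 0 0))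
    (eval_lt ?_ (eval_scalar (hs.arr 9 (by norm_num)) 0 0))
  simp only [eval_add, eval_var]
  have : ((s.setVar 2 0).setVar 3 0).var 1 = I.k := hs.var_one
  omega

theorem Stage.runs_parameterTerm (hs : Stage I 11 s) :
    Runs (fill 11 parameterTerm) ((fillTime parameterTerm).eval I.n) s (Stage I 12) := by
  refine hs.runs_fill (by simp [parameterTerm, scalar, Below])
    (by simp [parameterTerm, scalar, Avoids]) fun s' h => ?_
  change _ = (kernel I).k
  rw [h.arr_zero, kernel, apply_ite Instance.k]
  refine eval_ite (eval_scalar (hs.arr 10 (by norm_num)) 0 0) (eval_const 0) ?_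
  rw [eval_sub, eval_scalar (hs.arr 7 (by norm_num)) 0 0]
  exact congrArg (· - _) hs.var_one

theorem Stage.runs_vertexTerm (hs : Stage I 12 s) :
    Runs (fill 12 vertexTerm) ((fillTime vertexTerm).eval I.n) s (Stage I 13) := by
  refine hs.runs_fill (by simp [vertexTerm, scalar, Below, Term.eq, Term.not])
    (by simp [vertexTerm, scalar, Avoids, Term.eq, Term.not]) fun s' h => ?_
  change _ = (kernel I).n
  rw [h.arr_zero, kernel, apply_ite Instance.n]
  change _ = if Reject I then 4 else kernelOrder I
  rw [kernelOrder]
  have h9 : s.arr 9 0 0 = order (obstruction I.G) := hs.arr 9 (by norm_num)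
  refine eval_ite (eval_scalar (hs.arr 10 (by norm_num)) 0 0) (eval_const 4)
    (eval_ite (eval_eq (eval_scalar h9 0 0) (eval_const 0)) (eval_const 0) ?_)
  rw [eval_add, eval_scalar h9, eval_const]

theorem paw_adj_iff : ∀ i j : Fin 4, paw.Adj i j ↔
    ¬ (i : ℕ) = j ∧ ((i : ℕ) = 0 ∨ (j : ℕ) = 0 ∨ ((i : ℕ) ≤ 2 ∧ (j : ℕ) ≤ 2)) := by
  intro i j
  fin_cases i <;> fin_cases j <;> simp [paw]

/-- Ensures that the output matrix fits into the rows and columns that `fill` writes. -/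
theorem kernel_n_le_add (I : Instance) : (kernel I).n ≤ I.n + 4 := by
  have : order (obstruction I.G) ≤ I.n := (card_le_univ _).trans_eq (Fintype.card_fin _)
  unfold kernel
  split_ifs
  · exact Nat.le_add_left _ _
  · change kernelOrder I ≤ _
    rw [kernelOrder]
    split_ifs <;> omega

theorem Stage.arr_graphTerm {s' : State} (hs : Stage I 13 s) (h : Filled 0 graphTerm s s') :
    ∀ i j : Fin (kernel I).n, s'.arr 0 i j = ind ((kernel I).G.Adj i j) := by
  have h3 : ∀ i j : Fin I.n, s.arr 3 i j = ind ((obstruction I.G).Adj i j) :=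
    hs.arr 3 (by norm_num)
  have h6 : ∀ i j : Fin I.n, s.arr 6 i j = ind (Same (obstruction I.G) i j) :=
    hs.arr 6 (by norm_num)
  have h8 : ∀ i j : Fin I.n, s.arr 8 i j = rank (obstruction I.G) i := hs.arr 8 (by norm_num)
  have h10 := eval_scalar (s := s) (c := ind (Reject I)) (hs.arr 10 (by norm_num))
  intro i j
  have hn := kernel_n_le_add I
  rw [h.arr i (by rw [hs.var_zero]; omega) j (by rw [hs.var_zero]; omega)]
  have key : graphTerm.eval ((s.setVar 2 i).setVar 3 j) = ind (¬ (i : ℕ) = j ∧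
      if Reject I then (i : ℕ) = 0 ∨ (j : ℕ) = 0 ∨ ((i : ℕ) ≤ 2 ∧ (j : ℕ) ≤ 2)
      else ¬ ∃ x y : Fin I.n, ¬ Same (obstruction I.G) x x ∧ ¬ Same (obstruction I.G) y y ∧
        rank (obstruction I.G) x = i ∧ rank (obstruction I.G) y = j ∧
        (obstruction I.G).Adj x y) := by
    refine eval_and (eval_not (eval_eq ?_ ?_)) ((eval_ite (h10 i j)
      (eval_or (eval_eq ?_ ?_) (eval_or (eval_eq ?_ ?_) (eval_and (eval_le ?_ ?_) (eval_le ?_ ?_))))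
      (eval_not (eval_ex ?_ fun x => eval_ex ?_ fun y => eval_and (eval_not ?_)
        (eval_and (eval_not ?_) (eval_and (eval_eq ?_ ?_) (eval_and (eval_eq ?_ ?_) ?_)))))).trans
      (apply_ite _ _ _ _).symm)
    all_goals simp [eval_get, eval_var, eval_const, State.setVar, hs.var_zero, h3, h6, h8]
  rw [key]
  congr 1
  clear key
  by_cases hr : Reject I
  · have hk : kernel I = _ := if_pos hr
    rw [if_pos hr]
    -- The types of i and j depend on `kernel I`, so they are generalized before it is rewritten.
    revert i j
    rw [hk]
    exact fun i j => propext (paw_adj_iff i j).symm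
  · have hk : kernel I = _ := if_neg hr
    rw [if_neg hr, ← Fin.ext_iff]
    revert i j
    rw [hk]
    exact fun i j => rfl

theorem runs_kernelProg (I : Instance) :
    Runs kernelProg (kernelTime.eval I.n) I.init fun s => s.Output (kernel I) := by
  simp only [kernelTime, Polynomial.eval_add, Polynomial.eval_ofNat]
  refine (runs_reachProg (stage_init I)).seq fun s hs => ?_
  -- Array 2 is scratch memory with no required content, so it counts as computed.
  have hs : Stage I 3 s := ⟨hs.var_zero, hs.var_one, fun a ha => by
    rcases Nat.lt_succ_iff_lt_or_eq.1 ha with ha | rfl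
    · exact hs.arr a ha
    · trivial⟩
  refine hs.runs_obstructionTerm.seq fun s hs => ?_
  refine hs.runs_closedNbhdTerm.seq fun s hs => ?_
  refine hs.runs_goodTerm.seq fun s hs => ?_
  refine hs.runs_sameTerm.seq fun s hs => ?_
  refine hs.runs_costTerm.seq fun s hs => ?_
  refine hs.runs_rankTerm.seq fun s hs => ?_
  refine hs.runs_orderTerm.seq fun s hs => ?_
  refine hs.runs_rejectTerm.seq fun s hs => ?_
  refine hs.runs_parameterTerm.seq fun s hs => ?_
  refine hs.runs_vertexTerm.seq fun s hs => ?_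
  have hg := PawCompletion.runs_fill (a := 0) (t := graphTerm)
    (by simp [graphTerm, scalar, Below, Term.eq, Term.le, Term.or, Term.and, Term.ex, Term.not])
    (by simp [graphTerm, scalar, Avoids, Term.eq, Term.le, Term.or, Term.and, Term.ex, Term.not]) s
  rw [hs.var_zero] at hg
  refine hg.seq fun s' hs' => ?_
  refine (runs_assign _ _ _).seq ?_
  rintro _ rfl
  refine (runs_assign _ _ _).mono le_rfl ?_
  rintro _ rfl
  refine ⟨?_, ?_, fun i hi j hj => ?_⟩
  · rw [State.setVar_var_self]
    change s'.arr 12 0 0 = _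
    rw [hs'.arr_of_ne 12 (by norm_num)]
    exact hs.arr 12 (by norm_num)
  · rw [State.setVar_var_of_ne _ _ (by norm_num), State.setVar_var_self]
    change s'.arr 11 0 0 = _
    rw [hs'.arr_of_ne 11 (by norm_num)]
    exact hs.arr 11 (by norm_num)
  · exact (hs.arr_graphTerm hs' ⟨i, hi⟩ ⟨j, hj⟩).trans (adjEntry_eq (kernel I).G ⟨i, hi⟩ ⟨j, hj⟩).symm

/-- Coefficients are natural numbers, so the time bound in n carries over to the larger instance
size. -/
theorem eval_le_eval (b : Polynomial ℕ) {m n : ℕ} (h : m ≤ n) : b.eval m ≤ b.eval n := by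
  simp only [Polynomial.eval_eq_sum, Polynomial.sum]
  exact sum_le_sum fun i _ => Nat.mul_le_mul_left _ (Nat.pow_le_pow_left h i)

theorem polyTimeComputable_kernel : PolyTimeComputable kernel := by
  refine ⟨kernelProg, kernelTime, fun I => ?_⟩
  obtain ⟨t, s, h1, h2, h3⟩ := runs_kernelProg I
  exact ⟨t, s, h1, h2.trans (eval_le_eval _ (Nat.le_add_right _ _)), h3⟩

end Stages

end PawCompletion

theorem theorem1 :
    ∃ f : PawCompletion.Instance → PawCompletion.Instance,
      PawCompletion.PolyTimeComputable f ∧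
      ∀ I : PawCompletion.Instance,
        ((f I).IsYes ↔ I.IsYes) ∧
        (f I).k ≤ I.k ∧
        ((f I).n ≤ 38 * I.k ∨ (I.k = 0 ∧ ¬ I.IsYes ∧ (f I).n = 4)) :=
  ⟨PawCompletion.kernel, PawCompletion.polyTimeComputable_kernel, fun I =>
    ⟨PawCompletion.kernel_isYes_iff I, PawCompletion.kernel_k_le I, PawCompletion.kernel_n_le I⟩⟩
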